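/- **Model.** Let $q_{ch}\in\mathbb R^{n_{ch}}$ and $q_{pr},V_{sh}\in\mathbb R^{n_{pr}}$ be the independent network flows, the producer flows and the hot-water volumes of the storage tanks of a district heating system with $$J_{ch}\dot q_{ch}=f_{ch}(q_{ch})+u_{ch},\qquad J_{pr}\dot q_{pr}=-W(q_{pr})\theta+u_{pr},\qquad \dot V_{sh}=q_{pr}-Bq_{ch},$$ where $J_{ch}$ is symmetric positive definite, $J_{pr}$ is diagonal positive definite, $f_{ch}$ is continuously differentiable, $-f_{ch}$ is monotone, i.e. $(q-q')^\top(f_{ch}(q)-f_{ch}(q'))\le 0$ for all $q,q'$, $\theta\in\mathbb R^{n_{pr}}$ has positive entries, $W(q)=\mathrm{diag}(|q_i|q_i)$, and $B$ is a constant real $n_{pr}\times n_{ch}$ matrix. Let $q_{ch}^\star$, $V_{sh}^\star$ be constant setpoints, let $M_{ch},N_{ch},N_{pr},N_{sh},M_a,M_b$ be positive definite diagonal matrices, put $z_{pr}=q_{pr}-x_a+N_{sh}(V_{sh}-V_{sh}^\star)$ and $\tilde W(z_{pr})=W(z_{pr}+x_a-N_{sh}(V_{sh}-V_{sh}^\star))$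 (which equals $W(q_{pr})$), and close the loop with the controllers $$\dot x_{ch}=-M_{ch}(q_{ch}-q_{ch}^\star),\qquad u_{ch}=-N_{ch}(q_{ch}-q_{ch}^\star)+x_{ch},$$ $$\dot x_a=-M_a(V_{sh}-V_{sh}^\star),\qquad \dot x_b=-M_b\tilde W(z_{pr})z_{pr},$$ $$u_{pr}=\tilde W(z_{pr})x_b-\big(J_{pr}(M_a-N_{sh}^2)+I\big)(V_{sh}-V_{sh}^\star)-(J_{pr}N_{sh}+N_{pr})z_{pr}+J_{pr}N_{sh}(Bq_{ch}-x_a).$$ **Theorem.** (i) In the coordinates $(q_{ch},x_{ch},X)$ with $X=(J_{pr}z_{pr},V_{sh},M_a^{-1}x_a,M_b^{-1}x_b)$, which depend homeomorphically on $(q_{ch},x_{ch},q_{pr},V_{sh},x_a,x_b)$, the overall closed-loop system is equivalent to (has the same solutions as) the cascade of the subsystem $$\Sigma_{ch}:\quad J_{ch}\dot q_{ch}=f_{ch}(q_{ch})-N_{ch}(q_{ch}-q_{ch}^\star)+x_{ch},\qquad \dot x_{ch}=-M_{ch}(q_{ch}-q_{ch}^\star)$$ with the subsystem $$\Sigma_{pr,sh}:\quad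 \dot X=F(X)\nabla\tilde H(X)+(0,\ B(q_{ch}^\star-q_{ch}),\ 0,\ 0),$$ $$F(X)=\begin{bmatrix}-N_{pr}&-I&0&\tilde W(z_{pr})\\ I&-N_{sh}&I&0\\ 0&-I&0&0\\ -\tilde W(z_{pr})&0&0&0\end{bmatrix},$$ $$\tilde H(X)=\tfrac12(X-\bar X)^\top\mathrm{block.diag}(J_{pr}^{-1},I,M_a,M_b)(X-\bar X),\qquad \bar X=(0,V_{sh}^\star,M_a^{-1}Bq_{ch}^\star,M_b^{-1}\theta).$$ (ii) Suppose that at every equilibrium of the overall closed-loop system all producer flows are nonzero, $\bar q_{pr,i}\ne0$ for $i=1,\dots,n_{pr}$. Then the overall closed-loop system has a unique equilibrium. This equilibrium is locally asymptotically stable (it is Lyapunov stable; from every initial state close enough to it a solution exists for all $t\ge0$; and every such solution converges to it). For every solution on $[0,\infty)$ that starts close enough to it, $\lim_{t\to\infty}q_{ch}(t)=q_{ch}^\star$ and $\lim_{t\to\infty}V_{sh}(t)=V_{sh}^\star$. -/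

import Mathlib

open Matrix Filter Topology

noncomputable section

namespace DistrictHeating

/-! ### Stability notions for an autonomous ODE `ẋ = v x` -/

section Stability

variable {E : Type*} [NormedAddCommGroup E] [NormedSpace ℝ E]

/-- `x` solves `ẋ = v x` on the set of times `s` (one-sided derivatives at end points in `s`). -/
def IsSolutionOn (v : E → E) (x : ℝ → E) (s : Set ℝ) : Prop :=
  IsIntegralCurveOn x (fun _ => v) s

/-- `xe` is an equilibrium of `ẋ = v x`. -/
def IsEquilibrium (v : E → E) (xe : E) : Prop := v xe = 0

/-- Lyapunov stability of `xe`: solutions that start close to `xe` stay close to `xe` for as long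
as they are defined. -/
def IsStable (v : E → E) (xe : E) : Prop :=
  ∀ ε > 0, ∃ δ > 0, ∀ (T : ℝ) (x : ℝ → E),
    IsSolutionOn v x (Set.Ico 0 T) → dist (x 0) xe < δ → ∀ t ∈ Set.Ico 0 T, dist (x t) xe < ε

/-- Local attractivity of `xe`: from every initial state close to `xe` there is a solution for all
`t ≥ 0`, and every such solution converges to `xe`. -/
def IsLocallyAttractive (v : E → E) (xe : E) : Prop :=
  ∃ δ > 0, ∀ x₀ : E, dist x₀ xe < δ →
    (∃ x : ℝ → E, x 0 = x₀ ∧ IsSolutionOn v x (Set.Ici 0)) ∧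
    ∀ x : ℝ → E, x 0 = x₀ → IsSolutionOn v x (Set.Ici 0) → Tendsto x atTop (𝓝 xe)

/-- `xe` is a (locally) asymptotically stable equilibrium of `ẋ = v x`. -/
def IsLocallyAsymptoticallyStable (v : E → E) (xe : E) : Prop :=
  IsEquilibrium v xe ∧ IsStable v xe ∧ IsLocallyAttractive v xe

end Stability

/-! ### The hydraulic model

`Ch` indexes the independent flows `q_ch` and `Pr` the producers (and their storage tanks).
A diagonal matrix is stored as the vector of its diagonal entries, and it acts on vectors by
componentwise multiplication. -/

/-- The reduced-order hydraulic model of the district heating system. -/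
structure DHSystem (Ch Pr : Type*) [Fintype Ch] where
  /-- inertia matrix of the flows `q_ch` -/
  Jch : Matrix Ch Ch ℝ
  Jch_posDef : Jch.PosDef
  /-- diagonal of the inertia matrix of the producer flows -/
  Jpr : Pr → ℝ
  Jpr_pos : ∀ i, 0 < Jpr i
  /-- friction map of the flows `q_ch` -/
  fch : (Ch → ℝ) → (Ch → ℝ)
  fch_contDiff : ContDiff ℝ 1 fch
  /-- `-fch` is a monotone mapping -/
  fch_monotone : ∀ q q' : Ch → ℝ, 0 ≤ (q - q') ⬝ᵥ ((-fch q) - (-fch q'))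
  /-- friction coefficients of the producers -/
  θ : Pr → ℝ
  θ_pos : ∀ i, 0 < θ i
  /-- `(B q_ch)_i` is the flow leaving the hot layer of the `i`-th tank -/
  B : Matrix Pr Ch ℝ

/-- The (diagonal, positive definite) controller gains. -/
structure Gains (Ch Pr : Type*) where
  Mch : Ch → ℝ
  Nch : Ch → ℝ
  Npr : Pr → ℝ
  Nsh : Pr → ℝ
  Ma : Pr → ℝ
  Mb : Pr → ℝ
  Mch_pos : ∀ i, 0 < Mch i
  Nch_pos : ∀ i, 0 < Nch i
  Npr_pos : ∀ i, 0 < Npr i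
  Nsh_pos : ∀ i, 0 < Nsh i
  Ma_pos : ∀ i, 0 < Ma i
  Mb_pos : ∀ i, 0 < Mb i

/-- The constant setpoints `q_ch⋆` and `V_sh⋆`. -/
structure Setpoints (Ch Pr : Type*) where
  qch : Ch → ℝ
  Vsh : Pr → ℝ

/-- The diagonal `|q_i| q_i` of the matrix `W(q)`. -/
def W {Pr : Type*} (q : Pr → ℝ) : Pr → ℝ := fun i => |q i| * q i

/-! #### The model obtained from the edges of the network

The flows through the edges that do not belong to a producer are `q_E = 𝓕ᵀ q_ch` with the loop
matrix `𝓕 = [I G]`; edge `e` has inertia `J_e` and friction `θ_e |q_e| q_e`. Kirchhoff's voltage law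
then gives `J_ch = 𝓕 J_E 𝓕ᵀ` and `f_ch(q_ch) = -𝓕 f_E(𝓕ᵀ q_ch)`. The next facts show that these have
the properties that are required of a `DHSystem`. -/

section Network

theorem hasDerivAt_abs_mul_self (x : ℝ) : HasDerivAt (fun y : ℝ => |y| * y) (2 * |x|) x := by
  rcases lt_trichotomy x 0 with h | h | h
  · have h1 : HasDerivAt (fun y : ℝ => -(y ^ 2)) (2 * |x|) x := by
      have h2 : 2 * |x| = -(2 * x) := by rw [abs_of_neg h]; ring
      rw [h2]
      simpa using (hasDerivAt_pow 2 x).fun_neg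
    refine h1.congr_of_eventuallyEq ?_
    filter_upwards [eventually_lt_nhds h] with y hy
    rw [abs_of_neg hy]; ring
  · subst h
    rw [hasDerivAt_iff_tendsto_slope]
    have h1 : Tendsto (fun y : ℝ => |y|) (𝓝[≠] 0) (𝓝 (2 * |0|)) := by
      have : Tendsto (fun y : ℝ => |y|) (𝓝 0) (𝓝 |0|) := continuous_abs.tendsto 0
      simpa using this.mono_left nhdsWithin_le_nhds
    refine h1.congr' ?_
    filter_upwards [self_mem_nhdsWithin] with y hy
    have hy' : y ≠ 0 := hy
    simp [slope_def_field, hy']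
  · have h1 : HasDerivAt (fun y : ℝ => y ^ 2) (2 * |x|) x := by
      rw [abs_of_pos h]
      simpa using hasDerivAt_pow 2 x
    refine h1.congr_of_eventuallyEq ?_
    filter_upwards [eventually_gt_nhds h] with y hy
    rw [abs_of_pos hy]; ring

theorem contDiff_abs_mul_self : ContDiff ℝ 1 (fun y : ℝ => |y| * y) := by
  rw [contDiff_one_iff_deriv]
  refine ⟨fun x => (hasDerivAt_abs_mul_self x).differentiableAt, ?_⟩
  have : deriv (fun y : ℝ => |y| * y) = fun x => 2 * |x| :=
    funext fun x => (hasDerivAt_abs_mul_self x).deriv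
  rw [this]
  fun_prop

theorem monotone_abs_mul_self : Monotone (fun y : ℝ => |y| * y) :=
  monotone_of_deriv_nonneg (fun x => (hasDerivAt_abs_mul_self x).differentiableAt) fun x => by
    rw [(hasDerivAt_abs_mul_self x).deriv]; positivity

variable {Ch T Pr : Type*} [Fintype Ch] [DecidableEq Ch] [Fintype T]

/-- The loop matrix `𝓕 = [I G]`. -/
def loopMatrix (G : Matrix Ch T ℝ) : Matrix Ch (Ch ⊕ T) ℝ := Matrix.fromCols 1 G

/-- `f_ch(q_ch) = -𝓕 f_E(𝓕ᵀ q_ch)` with `f_E,e(q) = θ_e |q| q`. -/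
def networkFch (G : Matrix Ch T ℝ) (θE : Ch ⊕ T → ℝ) (q : Ch → ℝ) : Ch → ℝ :=
  -(loopMatrix G *ᵥ (θE * W ((loopMatrix G)ᵀ *ᵥ q)))

theorem networkFch_contDiff (G : Matrix Ch T ℝ) (θE : Ch ⊕ T → ℝ) :
    ContDiff ℝ 1 (networkFch G θE) := by
  rw [contDiff_pi]
  intro i
  refine ContDiff.neg (ContDiff.sum fun e _ => contDiff_const.mul (contDiff_const.mul ?_))
  refine contDiff_abs_mul_self.comp (?_ : ContDiff ℝ 1 fun q => ((loopMatrix G)ᵀ *ᵥ q) e)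
  exact ContDiff.sum fun k _ => contDiff_const.mul (contDiff_apply ℝ ℝ k)

theorem networkFch_monotone (G : Matrix Ch T ℝ) (θE : Ch ⊕ T → ℝ) (hθ : ∀ e, 0 ≤ θE e)
    (q q' : Ch → ℝ) :
    0 ≤ (q - q') ⬝ᵥ ((-networkFch G θE q) - (-networkFch G θE q')) := by
  simp only [networkFch, neg_neg]
  rw [← Matrix.mulVec_sub, Matrix.dotProduct_mulVec, ← Matrix.mulVec_transpose, Matrix.mulVec_sub]
  refine Finset.sum_nonneg fun e _ => ?_
  set a := ((loopMatrix G)ᵀ *ᵥ q)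
  set b := ((loopMatrix G)ᵀ *ᵥ q')
  have key : 0 ≤ (a e - b e) * (|a e| * a e - |b e| * b e) := by
    rcases le_total (a e) (b e) with h | h
    · exact mul_nonneg_of_nonpos_of_nonpos (sub_nonpos.2 h)
        (sub_nonpos.2 (monotone_abs_mul_self h))
    · exact mul_nonneg (sub_nonneg.2 h) (sub_nonneg.2 (monotone_abs_mul_self h))
  have := mul_nonneg (hθ e) key
  simp only [Pi.sub_apply, Pi.mul_apply, W]
  linarith

theorem networkJch_posDef [DecidableEq T] (G : Matrix Ch T ℝ) (JE : Ch ⊕ T → ℝ) (hJ : ∀ e, 0 ≤ JE e)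
    (hJ' : ∀ i, 0 < JE (.inl i)) :
    (loopMatrix G * Matrix.diagonal JE * (loopMatrix G)ᵀ).PosDef := by
  have h : loopMatrix G * Matrix.diagonal JE * (loopMatrix G)ᵀ =
      Matrix.diagonal (fun i => JE (.inl i)) +
        G * Matrix.diagonal (fun t => JE (.inr t)) * Gᴴ := by
    ext i j
    rw [Matrix.conjTranspose_eq_transpose_of_trivial]
    simp [loopMatrix, Matrix.mul_apply, Matrix.diagonal_apply, Matrix.one_apply]
    grind
  rw [h]
  exact (Matrix.PosDef.diagonal hJ').add_posSemidef
    ((Matrix.PosSemidef.diagonal fun t => hJ (.inr t)).mul_mul_conjTranspose_same G)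

/-- The hydraulic model of a network with loop matrix `[I G]`, edge inertias `JE`, friction
coefficients `θE` (zero for a pump), and producers with parameters `Jpr`, `θ`. The tank of producer
`i` feeds the edge `outlet i`. -/
def DHSystem.ofNetwork [DecidableEq T] (G : Matrix Ch T ℝ) (JE θE : Ch ⊕ T → ℝ) (hJ : ∀ e, 0 ≤ JE e)
    (hJ' : ∀ i, 0 < JE (.inl i)) (hθ : ∀ e, 0 ≤ θE e) (Jpr θ : Pr → ℝ) (hJpr : ∀ i, 0 < Jpr i)
    (hθpr : ∀ i, 0 < θ i) (outlet : Pr → Ch ⊕ T) : DHSystem Ch Pr where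
  Jch := loopMatrix G * Matrix.diagonal JE * (loopMatrix G)ᵀ
  Jch_posDef := networkJch_posDef G JE hJ hJ'
  Jpr := Jpr
  Jpr_pos := hJpr
  fch := networkFch G θE
  fch_contDiff := networkFch_contDiff G θE
  fch_monotone := networkFch_monotone G θE hθ
  θ := θ
  θ_pos := hθpr
  B := ((loopMatrix G)ᵀ).submatrix outlet id

end Network

/-- The state `(q_ch, x_ch, q_pr, V_sh, x_a, x_b)` of the overall closed-loop system. -/
abbrev State (Ch Pr : Type*) :=
  (Ch → ℝ) × (Ch → ℝ) × (Pr → ℝ) × (Pr → ℝ) × (Pr → ℝ) × (Pr → ℝ)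

namespace State

variable {Ch Pr : Type*}

def qch (x : State Ch Pr) : Ch → ℝ := x.1
def xch (x : State Ch Pr) : Ch → ℝ := x.2.1
def qpr (x : State Ch Pr) : Pr → ℝ := x.2.2.1
def Vsh (x : State Ch Pr) : Pr → ℝ := x.2.2.2.1
def xa (x : State Ch Pr) : Pr → ℝ := x.2.2.2.2.1
def xb (x : State Ch Pr) : Pr → ℝ := x.2.2.2.2.2

end State

section Dynamics

variable {Ch Pr : Type*} [Fintype Ch] [DecidableEq Ch] [Fintype Pr] [DecidableEq Pr]

/-! #### Open-loop plant -/

/-- `J_ch q̇_ch = f_ch(q_ch) + u_ch`, solved for `q̇_ch`. -/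
def DHSystem.qchDot (S : DHSystem Ch Pr) (qch uch : Ch → ℝ) : Ch → ℝ :=
  S.Jch⁻¹ *ᵥ (S.fch qch + uch)

/-- The friction map of the producers, `f_pr(q_pr) = - W(q_pr) θ`. -/
def DHSystem.fpr (S : DHSystem Ch Pr) (qpr : Pr → ℝ) : Pr → ℝ := -(W qpr * S.θ)

/-- `J_pr q̇_pr = f_pr(q_pr) + u_pr`, solved for `q̇_pr`. -/
def DHSystem.qprDot (S : DHSystem Ch Pr) (qpr upr : Pr → ℝ) : Pr → ℝ :=
  (S.fpr qpr + upr) / S.Jpr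

/-- `V̇_sh = q_pr - B q_ch`. -/
def DHSystem.VshDot (S : DHSystem Ch Pr) (qpr : Pr → ℝ) (qch : Ch → ℝ) : Pr → ℝ :=
  qpr - S.B *ᵥ qch

/-! #### Controllers -/

/-- Controller of the flows `q_ch`: `ẋ_ch = -M_ch (q_ch - q_ch⋆)`. -/
def xchDot (K : Gains Ch Pr) (r : Setpoints Ch Pr) (qch : Ch → ℝ) : Ch → ℝ :=
  -(K.Mch * (qch - r.qch))

/-- Controller of the flows `q_ch`: `u_ch = -N_ch (q_ch - q_ch⋆) + x_ch`. -/
def uch (K : Gains Ch Pr) (r : Setpoints Ch Pr) (qch xch : Ch → ℝ) : Ch → ℝ :=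
  -(K.Nch * (qch - r.qch)) + xch

/-- `z_pr = q_pr - x_a + N_sh (V_sh - V_sh⋆)`. -/
def zpr (K : Gains Ch Pr) (r : Setpoints Ch Pr) (qpr Vsh xa : Pr → ℝ) : Pr → ℝ :=
  qpr - xa + K.Nsh * (Vsh - r.Vsh)

/-- The diagonal of `W̃(z_pr)`, that is, of `W(q_pr)` at
`q_pr = z_pr + x_a - N_sh (V_sh - V_sh⋆)`. -/
def Wtilde (K : Gains Ch Pr) (r : Setpoints Ch Pr) (z Vsh xa : Pr → ℝ) : Pr → ℝ :=
  W (z + xa - K.Nsh * (Vsh - r.Vsh))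

/-- Volume controller: `ẋ_a = -M_a (V_sh - V_sh⋆)`. -/
def xaDot (K : Gains Ch Pr) (r : Setpoints Ch Pr) (Vsh : Pr → ℝ) : Pr → ℝ :=
  -(K.Ma * (Vsh - r.Vsh))

/-- Volume controller: `ẋ_b = -M_b W̃(z_pr) z_pr`. -/
def xbDot (K : Gains Ch Pr) (r : Setpoints Ch Pr) (z Vsh xa : Pr → ℝ) : Pr → ℝ :=
  -(K.Mb * (Wtilde K r z Vsh xa * z))

/-- Volume controller: the control law for `u_pr`; `Bqch` is the measured vector `B q_ch`. -/
def upr (S : DHSystem Ch Pr) (K : Gains Ch Pr) (r : Setpoints Ch Pr)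
    (z Vsh xa xb Bqch : Pr → ℝ) : Pr → ℝ :=
  Wtilde K r z Vsh xa * xb
    - (S.Jpr * (K.Ma - K.Nsh ^ 2) + 1) * (Vsh - r.Vsh)
    - (S.Jpr * K.Nsh + K.Npr) * z
    + S.Jpr * K.Nsh * (Bqch - xa)

/-! #### Overall closed loop -/

/-- The vector field of the overall closed-loop flow and volume dynamics: the plant together with
both controllers. -/
def closedLoop (S : DHSystem Ch Pr) (K : Gains Ch Pr) (r : Setpoints Ch Pr) (x : State Ch Pr) :
    State Ch Pr :=
  let z := zpr K r x.qpr x.Vsh x.xa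
  (S.qchDot x.qch (uch K r x.qch x.xch),
   xchDot K r x.qch,
   S.qprDot x.qpr (upr S K r z x.Vsh x.xa x.xb (S.B *ᵥ x.qch)),
   S.VshDot x.qpr x.qch,
   xaDot K r x.Vsh,
   xbDot K r z x.Vsh x.xa)

/-! #### The two subsystems and their cascade -/

/-- The subsystem `Σ_ch`, with state `(q_ch, x_ch)`:
`J_ch q̇_ch = f_ch(q_ch) - N_ch (q_ch - q_ch⋆) + x_ch`, `ẋ_ch = -M_ch (q_ch - q_ch⋆)`. -/
def sigmaCh (S : DHSystem Ch Pr) (K : Gains Ch Pr) (r : Setpoints Ch Pr)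
    (y : (Ch → ℝ) × (Ch → ℝ)) : (Ch → ℝ) × (Ch → ℝ) :=
  (S.Jch⁻¹ *ᵥ (S.fch y.1 - K.Nch * (y.1 - r.qch) + y.2), -(K.Mch * (y.1 - r.qch)))

/-- Index set of the Hamiltonian state `X = (J_pr z_pr, V_sh, M_a⁻¹ x_a, M_b⁻¹ x_b)`. -/
abbrev HamIdx (Pr : Type*) := (Pr ⊕ Pr) ⊕ (Pr ⊕ Pr)

/-- Stack four vectors. -/
def stack (a b c d : Pr → ℝ) : HamIdx Pr → ℝ := Sum.elim (Sum.elim a b) (Sum.elim c d)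

/-- `X̄ = (0, V_sh⋆, M_a⁻¹ B q_ch⋆, M_b⁻¹ θ)`. -/
def Xbar (S : DHSystem Ch Pr) (K : Gains Ch Pr) (r : Setpoints Ch Pr) : HamIdx Pr → ℝ :=
  stack 0 r.Vsh ((S.B *ᵥ r.qch) / K.Ma) (S.θ / K.Mb)

/-- The Hamiltonian
`H̃(X) = ½ (X - X̄)ᵀ block.diag(J_pr⁻¹, I, M_a, M_b) (X - X̄)`. -/
def hamiltonian (S : DHSystem Ch Pr) (K : Gains Ch Pr) (r : Setpoints Ch Pr)
    (X : HamIdx Pr → ℝ) : ℝ :=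
  (1 / 2 : ℝ) * ((X - Xbar S K r) ⬝ᵥ
    (Matrix.diagonal (stack S.Jpr⁻¹ 1 K.Ma K.Mb) *ᵥ (X - Xbar S K r)))

/-- `∇H̃(X)`, the vector of partial derivatives of `H̃`. -/
def gradHamiltonian (S : DHSystem Ch Pr) (K : Gains Ch Pr) (r : Setpoints Ch Pr)
    (X : HamIdx Pr → ℝ) : HamIdx Pr → ℝ :=
  fun k => fderiv ℝ (hamiltonian S K r) X (Pi.single k 1)

/-- `W̃` in terms of `X`, where `z_pr = J_pr⁻¹ X₁`, `V_sh = X₂` and `x_a = M_a X₃`. -/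
def WtildeX (S : DHSystem Ch Pr) (K : Gains Ch Pr) (r : Setpoints Ch Pr)
    (X : HamIdx Pr → ℝ) : Pr → ℝ :=
  Wtilde K r (fun i => X (.inl (.inl i)) / S.Jpr i) (fun i => X (.inl (.inr i)))
    (fun i => K.Ma i * X (.inr (.inl i)))

/-- The structure matrix `F(X)`, with block rows `(-N_pr, -I, 0, W̃)`, `(I, -N_sh, I, 0)`,
`(0, -I, 0, 0)`, `(-W̃, 0, 0, 0)`. -/
def structureMatrix (S : DHSystem Ch Pr) (K : Gains Ch Pr) (r : Setpoints Ch Pr)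
    (X : HamIdx Pr → ℝ) : Matrix (HamIdx Pr) (HamIdx Pr) ℝ :=
  Matrix.fromBlocks
    (Matrix.fromBlocks (-Matrix.diagonal K.Npr) (-1) 1 (-Matrix.diagonal K.Nsh))
    (Matrix.fromBlocks 0 (Matrix.diagonal (WtildeX S K r X)) 1 0)
    (Matrix.fromBlocks 0 (-1) (-Matrix.diagonal (WtildeX S K r X)) 0)
    0

/-- The interconnection term `Ψ(q_ch) = B (q_ch⋆ - q_ch)`. -/
def Psi (S : DHSystem Ch Pr) (r : Setpoints Ch Pr) (qch : Ch → ℝ) : Pr → ℝ :=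
  S.B *ᵥ (r.qch - qch)

/-- The subsystem `Σ_pr,sh` with input `ψ`: `Ẋ = F(X) ∇H̃(X) + (0, ψ, 0, 0)`. -/
def sigmaPrSh (S : DHSystem Ch Pr) (K : Gains Ch Pr) (r : Setpoints Ch Pr)
    (X : HamIdx Pr → ℝ) (ψ : Pr → ℝ) : HamIdx Pr → ℝ :=
  structureMatrix S K r X *ᵥ gradHamiltonian S K r X + stack 0 ψ 0 0

/-- The cascade: `Σ_ch` evolves autonomously and drives `Σ_pr,sh` through `ψ = Ψ(q_ch)`. -/
def cascade (S : DHSystem Ch Pr) (K : Gains Ch Pr) (r : Setpoints Ch Pr)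
    (p : ((Ch → ℝ) × (Ch → ℝ)) × (HamIdx Pr → ℝ)) :
    ((Ch → ℝ) × (Ch → ℝ)) × (HamIdx Pr → ℝ) :=
  (sigmaCh S K r p.1, sigmaPrSh S K r p.2 (Psi S r p.1.1))

/-- The change of coordinates from `(q_ch, x_ch, q_pr, V_sh, x_a, x_b)` to
`((q_ch, x_ch), X)` with `X = (J_pr z_pr, V_sh, M_a⁻¹ x_a, M_b⁻¹ x_b)`. -/
def toCascade (S : DHSystem Ch Pr) (K : Gains Ch Pr) (r : Setpoints Ch Pr) (x : State Ch Pr) :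
    ((Ch → ℝ) × (Ch → ℝ)) × (HamIdx Pr → ℝ) :=
  ((x.qch, x.xch),
   stack (S.Jpr * zpr K r x.qpr x.Vsh x.xa) x.Vsh (x.xa / K.Ma) (x.xb / K.Mb))

end Dynamics

end DistrictHeating

end

open DistrictHeating

/-! The control law is built so that differentiating `z_pr` cancels everything except `-N_pr z - v +
W̃ (x_b - θ)`, where `v` is the deviation of `V_sh`. The change of coordinates is affine, so
equivalence with the cascade is an algebraic identity of vector fields (`cascade_toCascade`)
followed by the chain rule.

At rest, the integrators force `q_ch` and `V_sh` to their setpoints, hence `q_pr = B q_ch⋆`. Nonzero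
producer flows make `W` invertible, which determines `x_a` and `x_b`.

The energies dissipate only in `q_ch`, `z_pr` and `V_sh`. No invariance principle is used: small
cross terms make the Lyapunov function strict. With deviations `a` of `x_a` and `b` of `x_b`, the
derivative of `a v` contains `a²`, and that of `w₀ J z b` contains `w₀ w b²`. Here `w` is the
current entry of `W(q_pr)` and `w₀ ≠ 0` its value at the equilibrium, so `w₀ w` stays close to `w₀²
> 0` locally. For `Σ_ch`, the product of `x_ch` with `J_ch q_ch` (as deviations) plays the same
role. These are `exists_prForm_bounds` and `exists_chForm_bounds`.

The input `ψ` costs a multiple of `|ψ|²`, paid for by a large enough weight on the form of `Σ_ch`.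
The total `V` then satisfies `V̇ ≤ -c V` near the equilibrium, and
`isLocallyAsymptoticallyStable_of_lyapunov` concludes. -/

namespace DistrictHeating

/-! ### Lyapunov's direct method, continuation of solutions, comparison of homogeneous functions -/

section Lyapunov

variable {E : Type*} [NormedAddCommGroup E] [NormedSpace ℝ E]

/-- A quantity that decays at rate `c` as long as it is below `η` stays below an exponential. -/
theorem exp_decay_of_deriv_le {f f' : ℝ → ℝ} {T c m η : ℝ} (hc : 0 < c) (hm : 0 < m) (hmη : m < η)
    (hf : ∀ t ∈ Set.Icc 0 T, HasDerivWithinAt f (f' t) (Set.Icc 0 T) t)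
    (hf' : ∀ t ∈ Set.Icc 0 T, f t < η → f' t ≤ -c * f t) (h0 : f 0 ≤ m) :
    ∀ t ∈ Set.Icc 0 T, f t ≤ m * Real.exp (-(c / 2) * t) := by
  have hB : ∀ t : ℝ, HasDerivAt (fun t => m * Real.exp (-(c / 2) * t))
      (m * (Real.exp (-(c / 2) * t) * (-(c / 2)))) t := fun t =>
    (((hasDerivAt_id t).const_mul (-(c / 2))).exp.const_mul m).congr_deriv (by simp)
  -- The barrier decays at half the rate, so at a contact point `f' ≤ -c f` lies strictly below the
  -- slope of the barrier. Contact also forces `f ≤ m < η`, where the decay hypothesis applies.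
  refine image_le_of_deriv_right_lt_deriv_boundary
    (fun t ht => (hf t ht).continuousWithinAt)
    (fun t ht => (hf t (Set.Ico_subset_Icc_self ht)).mono_of_mem_nhdsWithin
      (Icc_mem_nhdsGE_of_mem ht)) (by simpa using h0) hB ?_
  intro t ht hft
  have hpos := Real.exp_pos (-(c / 2) * t)
  have hle : Real.exp (-(c / 2) * t) ≤ 1 := Real.exp_le_one_iff.2 (by nlinarith [ht.1])
  have h1 : f t < η := by rw [hft]; nlinarith
  have h2 := hf' t (Set.Ico_subset_Icc_self ht) h1
  rw [hft] at h2
  have : 0 < c * (m * Real.exp (-(c / 2) * t)) := by positivity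
  linarith

theorem IsSolutionOn.mono {v : E → E} {x : ℝ → E} {s s' : Set ℝ} (h : IsSolutionOn v x s)
    (hs : s' ⊆ s) : IsSolutionOn v x s' := IsIntegralCurveOn.mono h hs

theorem IsSolutionOn.congr {v : E → E} {x y : ℝ → E} {s : Set ℝ} (h : IsSolutionOn v x s)
    (hxy : ∀ t ∈ s, y t = x t) : IsSolutionOn v y s := fun t ht => by
  have := (h t ht).congr hxy (hxy t ht)
  simpa only [hxy t ht] using this

theorem IsSolutionOn.comp_sub {v : E → E} {x : ℝ → E} {T a : ℝ}
    (h : IsSolutionOn v x (Set.Icc 0 T)) :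
    IsSolutionOn v (fun t => x (t - a)) (Set.Icc a (a + T)) := fun t ht => by
  have h1 : HasDerivWithinAt (fun t : ℝ => t - a) 1 (Set.Icc a (a + T)) t :=
    ((hasDerivAt_id t).sub_const a).hasDerivWithinAt
  have hmaps : Set.MapsTo (fun t : ℝ => t - a) (Set.Icc a (a + T)) (Set.Icc 0 T) := fun u hu =>
    ⟨sub_nonneg.2 hu.1, by linarith [hu.2]⟩
  simpa [Function.comp_def] using (h (t - a) (hmaps ht)).scomp t h1 hmaps

/-- Away from `b`, one of the two intervals does not have `t` in its closure, so its derivative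
condition is vacuous. At `b` the two one-sided derivatives agree, both being `v (x b)`. -/
theorem IsSolutionOn.union_Icc {v : E → E} {x : ℝ → E} {a b c : ℝ} (hab : a ≤ b) (hbc : b ≤ c)
    (h1 : IsSolutionOn v x (Set.Icc a b)) (h2 : IsSolutionOn v x (Set.Icc b c)) :
    IsSolutionOn v x (Set.Icc a c) := fun t ht => by
  rw [← Set.Icc_union_Icc_eq_Icc hab hbc]
  rcases lt_trichotomy t b with h | rfl | h
  · exact (h1 t ⟨ht.1, h.le⟩).union
      (HasFDerivWithinAt.of_notMem_closure (by rw [isClosed_Icc.closure_eq]; exact fun h' => absurd h'.1 h.not_ge))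
  · exact (h1 t ⟨hab, le_rfl⟩).union (h2 t ⟨le_rfl, hbc⟩)
  · exact HasDerivWithinAt.union
      (HasFDerivWithinAt.of_notMem_closure (by rw [isClosed_Icc.closure_eq]; exact fun h' => absurd h'.2 h.not_ge))
      (h2 t ⟨h.le, ht.2⟩)

theorem isSolutionOn_Ici_of_Icc {v : E → E} {x : ℝ → E} {τ : ℝ} (hτ : 0 < τ)
    (h : ∀ n : ℕ, IsSolutionOn v x (Set.Icc 0 (n * τ))) : IsSolutionOn v x (Set.Ici 0) :=
  fun t ht => by
  obtain ⟨n, hn⟩ := exists_nat_gt (t / τ)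
  have hn' : t < n * τ := (div_lt_iff₀ hτ).1 hn
  refine (h n t ⟨ht, hn'.le⟩).mono_of_mem_nhdsWithin ?_
  have := inter_mem_nhdsWithin (Set.Ici 0) (Iic_mem_nhds hn')
  rwa [Set.Ici_inter_Iic] at this

/-- If from every state in a set there is a solution on `[0, τ]` that ends in the set, then from
every state in the set there is a solution for all nonnegative times. -/
theorem exists_isSolutionOn_Ici {v : E → E} {A : Set E} {τ : ℝ} (hτ : 0 < τ)
    (hA : ∀ x₀ ∈ A, ∃ x : ℝ → E, x 0 = x₀ ∧ IsSolutionOn v x (Set.Icc 0 τ) ∧ x τ ∈ A)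
    {x₀ : E} (hx₀ : x₀ ∈ A) : ∃ x : ℝ → E, x 0 = x₀ ∧ IsSolutionOn v x (Set.Ici 0) := by
  choose! φ h0 hsol hend using hA
  let s : ℕ → E := fun n => Nat.rec x₀ (fun _ y => φ y τ) n
  have hs : ∀ n, s n ∈ A := fun n => by
    induction n with
    | zero => exact hx₀
    | succ n ih => exact hend _ ih
  let x : ℝ → E := fun t => φ (s ⌊t / τ⌋₊) (t - ⌊t / τ⌋₊ * τ)
  have hx : ∀ n : ℕ, ∀ t ∈ Set.Icc (n * τ) (n * τ + τ), x t = φ (s n) (t - n * τ) := by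
    intro n t ht
    have htn : (n : ℝ) ≤ t / τ := (le_div_iff₀ hτ).2 ht.1
    rcases ht.2.lt_or_eq with h | h
    · have : ⌊t / τ⌋₊ = n := by
        rw [Nat.floor_eq_iff ((Nat.cast_nonneg n).trans htn)]
        exact ⟨htn, (div_lt_iff₀ hτ).2 (by linarith)⟩
      simp only [x, this]
    -- At the right end point the floor already selects the next piece. The values agree because
    -- that piece starts where the `n`-th one ends.
    · have : ⌊t / τ⌋₊ = n + 1 := by
        have : t / τ = ((n + 1 : ℕ) : ℝ) := by rw [h]; field_simp; push_cast; ring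
        rw [this, Nat.floor_natCast]
      simp only [x, this]
      have e1 : t - ((n + 1 : ℕ) : ℝ) * τ = 0 := by rw [h]; push_cast; ring
      have e2 : t - (n : ℝ) * τ = τ := by rw [h]; ring
      rw [e1, e2]
      exact h0 _ (hs (n + 1))
  refine ⟨x, ?_, isSolutionOn_Ici_of_Icc hτ fun n => ?_⟩
  · have := hx 0 0 (by simp [hτ.le])
    simp only [Nat.cast_zero, zero_mul, sub_zero] at this
    exact this.trans (h0 _ (hs 0))
  · induction n with
    | zero =>
      have h1 := ((hsol _ (hs 0)).congr fun t ht => by simpa using hx 0 t (by simpa using ht))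
      exact h1.mono (by simp [hτ.le])
    | succ n ih =>
      refine ih.union_Icc (b := n * τ) (by positivity) (by push_cast; nlinarith) ?_
      have : ((n + 1 : ℕ) : ℝ) * τ = n * τ + τ := by push_cast; ring
      rw [this]
      exact (hsol _ (hs n)).comp_sub.congr (hx n)

/-- **Lyapunov's theorem**, for a strict Lyapunov function with quadratic lower bound; `D` is the
derivative of `V` along the solutions. -/
theorem isLocallyAsymptoticallyStable_of_lyapunov [CompleteSpace E] {v : E → E} {xe : E}
    (hv : ContDiffAt ℝ 1 v xe) (hve : v xe = 0) {V D : E → ℝ} {C c : ℝ}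
    (hVc : ContinuousAt V xe) (hV0 : V xe = 0) (hCpos : 0 < C) (hC : ∀ x, ‖x - xe‖ ^ 2 ≤ C * V x) (hc : 0 < c)
    (hD : ∀ᶠ x in 𝓝 xe, D x ≤ -c * V x)
    (hchain : ∀ (x : ℝ → E) (s : Set ℝ) (t : ℝ), HasDerivWithinAt x (v (x t)) s t →
      HasDerivWithinAt (fun t => V (x t)) (D (x t)) s t) :
    IsLocallyAsymptoticallyStable v xe := by
  have hsub : ∀ ε > 0, ∃ η > 0, ∀ x, V x < η → dist x xe < ε := by
    intro ε hε
    refine ⟨ε ^ 2 / C, by positivity, fun x hx => ?_⟩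
    rw [lt_div_iff₀ hCpos] at hx
    rw [dist_eq_norm]
    exact lt_of_pow_lt_pow_left₀ 2 hε.le (by linarith [hC x])
  have hnear : ∀ η > 0, ∃ δ > 0, ∀ x, dist x xe < δ → V x < η := by
    intro η hη
    have := hVc.eventually (gt_mem_nhds (by rwa [hV0] : V xe < η))
    exact Metric.eventually_nhds_iff.1 this
  obtain ⟨ρ, hρ, hDρ⟩ := Metric.eventually_nhds_iff.1 hD
  obtain ⟨η, hη, hηρ⟩ := hsub ρ hρ
  have hdecay : ∀ m, 0 < m → m < η → ∀ (T : ℝ) (x : ℝ → E), IsSolutionOn v x (Set.Icc 0 T) →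
      V (x 0) ≤ m → ∀ t ∈ Set.Icc 0 T, V (x t) ≤ m * Real.exp (-(c / 2) * t) :=
    fun m hm hmη T x hx h0 => exp_decay_of_deriv_le hc hm hmη
      (fun t ht => hchain x _ t (hx t ht)) (fun t _ h => hDρ (hηρ _ h)) h0
  have hexp : ∀ m > 0, ∀ t ≥ 0, m * Real.exp (-(c / 2) * t) ≤ m := fun m hm t ht =>
    mul_le_of_le_one_right hm.le (Real.exp_le_one_iff.2 (by nlinarith))
  refine ⟨hve, ?_, ?_⟩
  · intro ε hε
    obtain ⟨μ, hμ, hμε⟩ := hsub ε hε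
    obtain ⟨m, hm, hmlt⟩ := exists_between (lt_min hμ hη)
    obtain ⟨δ, hδ, hδm⟩ := hnear m hm
    refine ⟨δ, hδ, fun T x hx h0 t ht => hμε _ ?_⟩
    -- The decay estimate is applied on `[0, t]`, since the solution is only given on a half-open
    -- interval.
    have h1 := hdecay m hm (hmlt.trans_le (min_le_right _ _)) t x
      (hx.mono fun u hu => ⟨hu.1, hu.2.trans_lt ht.2⟩) (hδm _ h0).le t ⟨ht.1, le_rfl⟩
    exact (h1.trans (hexp m hm t ht.1)).trans_lt (hmlt.trans_le (min_le_left _ _))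
  -- Picard–Lindelöf gives one existence time for all initial states in a ball. The sublevel set `V
  -- ≤ m` lies in that ball and is not left, so pieces of length `τ / 2` can be concatenated
  -- forever.
  · obtain ⟨r, hr, τ, hτ, hpl⟩ :=
      hv.exists_forall_mem_closedBall_exists_eq_forall_mem_Ioo_hasDerivAt 0
    obtain ⟨μ, hμ, hμr⟩ := hsub r hr
    obtain ⟨m, hm, hmlt⟩ := exists_between (lt_min hμ hη)
    have hmη := hmlt.trans_le (min_le_right _ _)
    obtain ⟨δ, hδ, hδm⟩ := hnear m hm
    refine ⟨δ, hδ, fun x₀ hx₀ => ⟨?_, ?_⟩⟩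
    · refine exists_isSolutionOn_Ici (A := {x | V x ≤ m}) (half_pos hτ) ?_ (hδm _ hx₀).le
      intro y hy
      obtain ⟨x, hx0, hx⟩ := hpl y
        (hμr y ((show V y ≤ m from hy).trans_lt (hmlt.trans_le (min_le_left _ _)))).le
      have hsol : IsSolutionOn v x (Set.Icc 0 (τ / 2)) := fun t ht =>
        (hx t ⟨by linarith [ht.1], by linarith [ht.2]⟩).hasDerivWithinAt
      have h1 := hdecay m hm hmη _ x hsol (by rw [hx0]; exact hy) (τ / 2)
        ⟨by positivity, le_rfl⟩
      exact ⟨x, hx0, hsol, h1.trans (hexp m hm _ (by positivity))⟩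
    · intro x hx0 hx
      have hlim : Tendsto (fun t => m * Real.exp (-(c / 2) * t)) atTop (𝓝 0) := by
        have : Tendsto (fun t : ℝ => -(c / 2) * t) atTop atBot :=
          tendsto_id.const_mul_atTop_of_neg (by linarith)
        simpa using (Real.tendsto_exp_atBot.comp this).const_mul m
      rw [Metric.tendsto_nhds]
      intro ε hε
      obtain ⟨μ', hμ', hμε⟩ := hsub ε hε
      filter_upwards [hlim.eventually (gt_mem_nhds hμ'), eventually_ge_atTop 0] with t ht ht0
      exact hμε _ ((hdecay m hm hmη t x (hx.mono Set.Icc_subset_Ici_self)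
        (by rw [hx0]; exact (hδm _ hx₀).le) t ⟨ht0, le_rfl⟩).trans_lt ht)

/-- On a finite-dimensional space, a function that is homogeneous of degree two is bounded by a
multiple of a positive one. -/
theorem exists_le_mul_of_homogeneous [FiniteDimensional ℝ E] {Q R : E → ℝ} (hQ : Continuous Q)
    (hR : Continuous R) (hQ2 : ∀ (a : ℝ) x, Q (a • x) = a ^ 2 * Q x)
    (hR2 : ∀ (a : ℝ) x, R (a • x) = a ^ 2 * R x) (hpos : ∀ x, x ≠ 0 → 0 < Q x) :
    ∃ c > 0, ∀ x, R x ≤ c * Q x := by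
  have hcpt : IsCompact (Metric.sphere (0 : E) 1) := isCompact_sphere 0 1
  have hne : ∀ x ∈ Metric.sphere (0 : E) 1, x ≠ 0 := fun x hx h => by simp [h] at hx
  obtain ⟨c, hc⟩ := (hcpt.bddAbove_image (f := fun x => R x / Q x)
    (hR.continuousOn.div hQ.continuousOn fun x hx => (hpos x (hne x hx)).ne'))
  refine ⟨max c 1, by positivity, fun x => ?_⟩
  by_cases hx : x = 0
  · have h1 := hQ2 0 0
    have h2 := hR2 0 0
    simp only [zero_smul] at h1 h2
    rw [hx, h1, h2]; simp
  · have hn : 0 < ‖x‖ := norm_pos_iff.2 hx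
    have hmem : ‖x‖⁻¹ • x ∈ Metric.sphere (0 : E) 1 := by
      simp [norm_smul, hn.ne']
    have h1 := hc ⟨_, hmem, rfl⟩
    simp only [hQ2, hR2] at h1
    have hQx := hpos x hx
    rw [mul_div_mul_left _ _ (by positivity), div_le_iff₀ hQx] at h1
    exact h1.trans (mul_le_mul_of_nonneg_right (le_max_left _ _) hQx.le)

end Lyapunov

/-! ### Strict Lyapunov estimates for one producer and for `Σ_ch` -/

section Estimates

theorem eventually_mul_le (A : ℝ) {B : ℝ} (hB : 0 < B) : ∀ᶠ ε in 𝓝[>] (0 : ℝ), ε * A ≤ B := by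
  have : Tendsto (fun ε : ℝ => ε * A) (𝓝 0) (𝓝 0) := by
    simpa using (tendsto_id (α := ℝ) (x := 𝓝 0)).mul_const A
  exact ((this.eventually (gt_mem_nhds hB)).mono fun _ h => h.le).filter_mono nhdsWithin_le_nhds

/-- Rescale a function with lower bound `p * s` and dissipation `c * s`. -/
theorem exists_scale {p c : ℝ} (hp : 0 < p) (hc : 0 < c) :
    ∃ k > 0, (∀ s A : ℝ, 0 ≤ s → p * s ≤ A → s ≤ k * A) ∧
      ∀ s D R : ℝ, 0 ≤ s → D ≤ -(c * s) + R → k * D ≤ -s + k * R := by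
  refine ⟨max p⁻¹ c⁻¹, by positivity, fun s A hs h => ?_, fun s D R hs h => ?_⟩
  · calc s = p⁻¹ * (p * s) := by field_simp
      _ ≤ max p⁻¹ c⁻¹ * (p * s) := by gcongr; exact le_max_left _ _
      _ ≤ _ := by gcongr
  · have h1 : s ≤ max p⁻¹ c⁻¹ * (c * s) := by
      calc s = c⁻¹ * (c * s) := by field_simp
        _ ≤ _ := by gcongr; exact le_max_right _ _
    have h2 := mul_le_mul_of_nonneg_left h (show 0 ≤ max p⁻¹ c⁻¹ by positivity)
    linarith

/-- The Lyapunov function of one producer: the energy, with cross terms that make its derivative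
negative definite. -/
noncomputable def prForm (J Ma Mb w₀ ε z v a b : ℝ) : ℝ :=
  (J * z ^ 2 + v ^ 2 + a ^ 2 / Ma + b ^ 2 / Mb) / 2 - ε * (a * v + w₀ * J * (z * b))

/-- The skew couplings cancel in the energy rate, leaving `-Np z² - Ns v² + v ψ`. The cross terms
add `-ε a²` and `-ε w₀ w b²`; their remaining contributions are absorbed by Young's inequality for
small `ε`. The window on `w₀ w` keeps the bounds uniform in the varying friction coefficient. -/
theorem exists_prForm_bounds {J Np Ns Ma Mb w₀ : ℝ} (hJ : 0 < J) (hNp : 0 < Np) (hNs : 0 < Ns)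
    (hMa : 0 < Ma) (hMb : 0 < Mb) (hw₀ : w₀ ≠ 0) :
    ∃ ε k C : ℝ, 0 < k ∧ 0 ≤ C ∧
      (∀ z v a b, z ^ 2 + v ^ 2 + a ^ 2 + b ^ 2 ≤ k * prForm J Ma Mb w₀ ε z v a b) ∧
      ∀ w, w₀ ^ 2 / 2 ≤ w₀ * w → w₀ * w ≤ 2 * w₀ ^ 2 → ∀ ψ z v a b,
        k * (z * (-Np * z - v + w * b) + v * (z - Ns * v + a + ψ) - a * v - b * (w * z)
          - ε * (-Ma * v * v + a * (z - Ns * v + a + ψ)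
            + w₀ * ((-Np * z - v + w * b) * b - J * z * (Mb * w * z)))) ≤
          -(z ^ 2 + v ^ 2 + a ^ 2 + b ^ 2) + C * ψ ^ 2 := by
  have hw2 : 0 < w₀ ^ 2 := by positivity
  -- The first and last bounds keep the cross-term derivative within the damping of `z` and `v`; the
  -- other four keep the cross terms within half the energy. The last uses `Ns / 4` because another
  -- `Ns / 4` is spent on `v ψ`.
  have hev := (eventually_mul_le (2 + 2 * Np ^ 2 + 2 * (J * Mb * w₀ ^ 2)) (half_pos hNp)).and <|
    (eventually_mul_le 1 (half_pos (inv_pos.2 hMb))).and <|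
    (eventually_mul_le (w₀ ^ 2 * J ^ 2) (half_pos hJ)).and <|
    (eventually_mul_le 1 (half_pos (inv_pos.2 hMa))).and <|
    (eventually_mul_le 1 (half_pos one_pos)).and <|
    (eventually_mul_le (Ma + 2 * Ns ^ 2 + 2) (show 0 < Ns / 4 by positivity)).and
    eventually_mem_nhdsWithin
  obtain ⟨ε, h1, h2, h3, h4, h5, h6, (hε : 0 < ε)⟩ := hev.exists
  obtain ⟨p, hp, hpJ, hp1, hpa, hpb⟩ : ∃ p > 0, p ≤ J / 4 ∧ p ≤ 1 / 4 ∧ p ≤ Ma⁻¹ / 4 ∧ p ≤ Mb⁻¹ / 4 :=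
    ⟨min (min (J / 4) (1 / 4)) (min (Ma⁻¹ / 4) (Mb⁻¹ / 4)), by positivity, by simp, by simp,
      by simp, by simp⟩
  obtain ⟨c, hc, hcp, hcs, hca, hcb⟩ : ∃ c > 0, c ≤ Np / 2 ∧ c ≤ Ns / 2 ∧ c ≤ ε / 2 ∧
      c ≤ ε * (w₀ ^ 2 / 4) :=
    ⟨min (min (Np / 2) (Ns / 2)) (min (ε / 2) (ε * (w₀ ^ 2 / 4))), by positivity, by simp, by simp,
      by simp, by simp⟩
  have hlow : ∀ z v a b, p * (z ^ 2 + v ^ 2 + a ^ 2 + b ^ 2) ≤ prForm J Ma Mb w₀ ε z v a b := by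
    intro z v a b
    have e1 : ε * (a * v) ≤ ε * 1 / 2 * a ^ 2 + ε * 1 / 2 * v ^ 2 := by
      nlinarith [mul_nonneg hε.le (sq_nonneg (a - v))]
    have e2 : ε * (w₀ * J * (z * b)) ≤ ε * (w₀ ^ 2 * J ^ 2) / 2 * z ^ 2 + ε * 1 / 2 * b ^ 2 := by
      nlinarith [mul_nonneg hε.le (sq_nonneg (w₀ * J * z - b))]
    have k1 := mul_le_mul_of_nonneg_right h4 (sq_nonneg a)
    have k2 := mul_le_mul_of_nonneg_right h5 (sq_nonneg v)
    have k3 := mul_le_mul_of_nonneg_right h3 (sq_nonneg z)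
    have k4 := mul_le_mul_of_nonneg_right h2 (sq_nonneg b)
    have m1 := mul_le_mul_of_nonneg_right hpa (sq_nonneg a)
    have m2 := mul_le_mul_of_nonneg_right hp1 (sq_nonneg v)
    have m3 := mul_le_mul_of_nonneg_right hpJ (sq_nonneg z)
    have m4 := mul_le_mul_of_nonneg_right hpb (sq_nonneg b)
    simp only [prForm, div_eq_mul_inv (a ^ 2), div_eq_mul_inv (b ^ 2)]
    linarith
  have hdiss : ∀ w, w₀ ^ 2 / 2 ≤ w₀ * w → w₀ * w ≤ 2 * w₀ ^ 2 → ∀ ψ z v a b,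
        (z * (-Np * z - v + w * b) + v * (z - Ns * v + a + ψ) - a * v - b * (w * z)
          - ε * (-Ma * v * v + a * (z - Ns * v + a + ψ)
            + w₀ * ((-Np * z - v + w * b) * b - J * z * (Mb * w * z)))) ≤
          -(c * (z ^ 2 + v ^ 2 + a ^ 2 + b ^ 2)) + (2 * ε + Ns⁻¹) * ψ ^ 2 := by
    intro w hw hw' ψ z v a b
    have e0 : v * ψ ≤ Ns / 4 * v ^ 2 + Ns⁻¹ * ψ ^ 2 := by
      have : 0 ≤ Ns⁻¹ * (Ns / 2 * v - ψ) ^ 2 := by positivity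
      have e : Ns⁻¹ * (Ns / 2 * v - ψ) ^ 2 = Ns / 4 * v ^ 2 + Ns⁻¹ * ψ ^ 2 - v * ψ := by
        field_simp; ring
      linarith
    have e1 : -(a * z) + Ns * a * v - a * ψ - a ^ 2 ≤
        2 * z ^ 2 + 2 * Ns ^ 2 * v ^ 2 + 2 * ψ ^ 2 - a ^ 2 / 2 := by
      nlinarith [sq_nonneg (a + 4 * z), sq_nonneg (a - 4 * (Ns * v)), sq_nonneg (a + 4 * ψ)]
    have e2 : w₀ * (Np * z * b + v * b) ≤ w₀ ^ 2 * b ^ 2 / 4 + 2 * Np ^ 2 * z ^ 2 + 2 * v ^ 2 := by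
      nlinarith [sq_nonneg (w₀ * b - 4 * (Np * z)), sq_nonneg (w₀ * b - 4 * v)]
    have e3 := mul_le_mul_of_nonneg_right hw (sq_nonneg b)
    have e4 : J * Mb * (w₀ * w) * z ^ 2 ≤ J * Mb * (2 * w₀ ^ 2) * z ^ 2 := by gcongr
    have e5 : (-(a * z) + Ns * a * v - a * ψ - a ^ 2) + Ma * v ^ 2 + w₀ * (Np * z * b + v * b)
        - w₀ * w * b ^ 2 + J * Mb * (w₀ * w) * z ^ 2 ≤
        (2 + 2 * Np ^ 2 + 2 * (J * Mb * w₀ ^ 2)) * z ^ 2 + (Ma + 2 * Ns ^ 2 + 2) * v ^ 2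
          + 2 * ψ ^ 2 - a ^ 2 / 2 - w₀ ^ 2 / 4 * b ^ 2 := by linarith
    have e6 := mul_le_mul_of_nonneg_left e5 hε.le
    have k1 := mul_le_mul_of_nonneg_right h1 (sq_nonneg z)
    have k2 := mul_le_mul_of_nonneg_right h6 (sq_nonneg v)
    have m1 := mul_le_mul_of_nonneg_right hcp (sq_nonneg z)
    have m2 := mul_le_mul_of_nonneg_right hcs (sq_nonneg v)
    have m3 := mul_le_mul_of_nonneg_right hca (sq_nonneg a)
    have m4 := mul_le_mul_of_nonneg_right hcb (sq_nonneg b)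
    linarith
  obtain ⟨k, hk, hk1, hk2⟩ := exists_scale hp hc
  exact ⟨ε, k, k * (2 * ε + Ns⁻¹), hk, by positivity,
    fun z v a b => hk1 _ _ (by positivity) (hlow z v a b), fun w hw hw' ψ z v a b =>
      (hk2 _ _ _ (by positivity) (hdiss w hw hw' ψ z v a b)).trans_eq (by rw [mul_assoc])⟩

variable {ι : Type*} [Fintype ι]

theorem dotProduct_self_nonneg' (u : ι → ℝ) : 0 ≤ u ⬝ᵥ u :=
  Finset.sum_nonneg fun i _ => mul_self_nonneg (u i)

theorem dotProduct_self_pos {u : ι → ℝ} (hu : u ≠ 0) : 0 < u ⬝ᵥ u :=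
  (dotProduct_self_nonneg' u).lt_of_ne fun h => hu (dotProduct_self_eq_zero.1 h.symm)

theorem dotProduct_le_add_sq (u w : ι → ℝ) : u ⬝ᵥ w ≤ u ⬝ᵥ u / 4 + w ⬝ᵥ w := by
  simp only [dotProduct, Finset.sum_div, ← Finset.sum_add_distrib]
  exact Finset.sum_le_sum fun i _ => by nlinarith [sq_nonneg (u i - 2 * w i)]

theorem dotProduct_mul_self_pos {M u : ι → ℝ} (hM : ∀ i, 0 < M i) (hu : u ≠ 0) :
    0 < u ⬝ᵥ (M * u) := by
  obtain ⟨i, hi⟩ := Function.ne_iff.1 hu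
  refine Finset.sum_pos' (fun j _ => ?_) ⟨i, Finset.mem_univ i, ?_⟩
  · have := mul_nonneg (hM j).le (mul_self_nonneg (u j))
    simp only [Pi.mul_apply]; linarith
  · have := mul_pos (hM i) (mul_self_pos.2 hi)
    simp only [Pi.mul_apply]; linarith

/-- The Lyapunov function of the subsystem `Σ_ch`: the energy, with a cross term that makes its
derivative negative definite. -/
noncomputable def chForm (J : Matrix ι ι ℝ) (M : ι → ℝ) (ε : ℝ) (y x : ι → ℝ) : ℝ :=
  (y ⬝ᵥ (J *ᵥ y) + x ⬝ᵥ (M⁻¹ * x)) / 2 - ε * (x ⬝ᵥ (J *ᵥ y))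

/-- Here `g` stands for `f_ch(q) - f_ch(q⋆)`: monotonicity gives it the right sign against `y`, and
a local Lipschitz bound gives `Λ`. The energy rate does not damp `x`; the cross term supplies `-ε x
⬝ᵥ x`, and its other terms are dominated by `N` for small `ε`. -/
theorem exists_chForm_bounds {J : Matrix ι ι ℝ} (hJ : J.PosDef) {M N : ι → ℝ}
    (hM : ∀ i, 0 < M i) (hN : ∀ i, 0 < N i) (Λ : ℝ) :
    ∃ ε k : ℝ, 0 < k ∧ (∀ y x, y ⬝ᵥ y + x ⬝ᵥ x ≤ k * chForm J M ε y x) ∧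
      ∀ g y x : ι → ℝ, y ⬝ᵥ g ≤ 0 → g ⬝ᵥ g ≤ Λ * (y ⬝ᵥ y) →
        k * (y ⬝ᵥ (g - N * y + x) - x ⬝ᵥ y
          - ε * (-((M * y) ⬝ᵥ (J *ᵥ y)) + x ⬝ᵥ (g - N * y + x))) ≤ -(y ⬝ᵥ y + x ⬝ᵥ x) := by
  have hself : Continuous fun u : ι → ℝ => u ⬝ᵥ u := by fun_prop
  have hself2 : ∀ (a : ℝ) (u : ι → ℝ), (a • u) ⬝ᵥ (a • u) = a ^ 2 * (u ⬝ᵥ u) := fun a u => by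
    simp only [smul_dotProduct, dotProduct_smul, smul_eq_mul]; ring
  have hJpos : ∀ y : ι → ℝ, y ≠ 0 → 0 < y ⬝ᵥ (J *ᵥ y) := fun y hy => by
    simpa using hJ.dotProduct_mulVec_pos hy
  obtain ⟨α, hα, hα'⟩ := exists_le_mul_of_homogeneous (Q := fun y : ι → ℝ => y ⬝ᵥ (N * y))
    (by fun_prop) hself (fun a u => by
      simp only [smul_dotProduct, dotProduct_smul, mul_smul_comm, smul_eq_mul]; ring)
    hself2 fun y hy => dotProduct_mul_self_pos hN hy
  obtain ⟨β, hβ, hβ'⟩ := exists_le_mul_of_homogeneous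
    (R := fun y : ι → ℝ => (M * y) ⬝ᵥ (J *ᵥ y) + (N * y) ⬝ᵥ (N * y)) hself
    (by fun_prop) hself2 (fun a u => by
      simp only [smul_dotProduct, dotProduct_smul, mul_smul_comm, smul_eq_mul, mulVec_smul]; ring)
    fun y hy => dotProduct_self_pos hy
  obtain ⟨j, hj, hj'⟩ := exists_le_mul_of_homogeneous (Q := fun y : ι → ℝ => y ⬝ᵥ (J *ᵥ y))
    (by fun_prop) hself (fun a u => by
      simp only [smul_dotProduct, dotProduct_smul, mulVec_smul, smul_eq_mul]; ring)
    hself2 fun y hy => hJpos y hy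
  obtain ⟨μ, hμ, hμ'⟩ := exists_le_mul_of_homogeneous (Q := fun y : ι → ℝ => y ⬝ᵥ (M⁻¹ * y))
    (by fun_prop) hself (fun a u => by
      simp only [smul_dotProduct, dotProduct_smul, mul_smul_comm, smul_eq_mul]; ring)
    hself2 fun y hy => dotProduct_mul_self_pos (fun i => inv_pos.2 (hM i)) hy
  obtain ⟨ζ, hζ, hζ'⟩ := exists_le_mul_of_homogeneous
    (R := fun y : ι → ℝ => (J *ᵥ y) ⬝ᵥ (J *ᵥ y)) hself
    (by fun_prop) hself2 (fun a u => by
      simp only [smul_dotProduct, dotProduct_smul, mulVec_smul, smul_eq_mul]; ring)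
    fun y hy => dotProduct_self_pos hy
  -- The first bound serves the dissipation; the next two leave a positive multiple of the energy
  -- after the cross term is subtracted.
  have hev := (eventually_mul_le (β + Λ) (half_pos (inv_pos.2 hα))).and <|
    (eventually_mul_le ζ (show 0 < j⁻¹ / 4 by positivity)).and <|
    (eventually_mul_le 1 (show 0 < μ⁻¹ by positivity)).and eventually_mem_nhdsWithin
  obtain ⟨ε, h1, h2, h3, (hε : 0 < ε)⟩ := hev.exists
  obtain ⟨p, hp, hpj, hpm⟩ : ∃ p > 0, p ≤ j⁻¹ / 4 ∧ p ≤ μ⁻¹ / 4 :=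
    ⟨min (j⁻¹ / 4) (μ⁻¹ / 4), by positivity, by simp, by simp⟩
  obtain ⟨c, hc, hca, hcε⟩ : ∃ c > 0, c ≤ α⁻¹ / 2 ∧ c ≤ ε / 2 :=
    ⟨min (α⁻¹ / 2) (ε / 2), by positivity, by simp, by simp⟩
  have hlow : ∀ y x, p * (y ⬝ᵥ y + x ⬝ᵥ x) ≤ chForm J M ε y x := by
    intro y x
    have hy := dotProduct_self_nonneg' y
    have hx := dotProduct_self_nonneg' x
    have e1 := mul_le_mul_of_nonneg_left
      ((dotProduct_le_add_sq x (J *ᵥ y)).trans (add_le_add_right (hζ' y) _)) hε.le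
    have e2 : j⁻¹ * (y ⬝ᵥ y) ≤ y ⬝ᵥ (J *ᵥ y) := by
      rw [inv_mul_le_iff₀ hj]; exact hj' y
    have e3 : μ⁻¹ * (x ⬝ᵥ x) ≤ x ⬝ᵥ (M⁻¹ * x) := by
      rw [inv_mul_le_iff₀ hμ]; exact hμ' x
    have k1 := mul_le_mul_of_nonneg_right h2 hy
    have k2 := mul_le_mul_of_nonneg_right h3 hx
    have m1 := mul_le_mul_of_nonneg_right hpj hy
    have m2 := mul_le_mul_of_nonneg_right hpm hx
    simp only [chForm]
    linarith
  have hdiss : ∀ g y x : ι → ℝ, y ⬝ᵥ g ≤ 0 → g ⬝ᵥ g ≤ Λ * (y ⬝ᵥ y) →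
      y ⬝ᵥ (g - N * y + x) - x ⬝ᵥ y
          - ε * (-((M * y) ⬝ᵥ (J *ᵥ y)) + x ⬝ᵥ (g - N * y + x)) ≤ -(c * (y ⬝ᵥ y + x ⬝ᵥ x)) := by
    intro g y x hg hgΛ
    have hy := dotProduct_self_nonneg' y
    have hx := dotProduct_self_nonneg' x
    have e1 := dotProduct_le_add_sq x (-g)
    have e2 := dotProduct_le_add_sq x (N * y)
    have e3 := hβ' y
    simp only [dotProduct_neg, neg_dotProduct, neg_neg] at e1
    have e4 : α⁻¹ * (y ⬝ᵥ y) ≤ y ⬝ᵥ (N * y) := by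
      rw [inv_mul_le_iff₀ hα]; exact hα' y
    have e5 : (M * y) ⬝ᵥ (J *ᵥ y) - (x ⬝ᵥ g - x ⬝ᵥ (N * y) + x ⬝ᵥ x) ≤
        (β + Λ) * (y ⬝ᵥ y) - x ⬝ᵥ x / 2 := by linarith
    have e6 := mul_le_mul_of_nonneg_left e5 hε.le
    have k1 := mul_le_mul_of_nonneg_right h1 hy
    have m1 := mul_le_mul_of_nonneg_right hca hy
    have m2 := mul_le_mul_of_nonneg_right hcε hx
    simp only [dotProduct_add, dotProduct_sub, dotProduct_comm x y]
    linarith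
  obtain ⟨k, hk, hk1, hk2⟩ := exists_scale hp hc
  have hs : ∀ y x : ι → ℝ, 0 ≤ y ⬝ᵥ y + x ⬝ᵥ x := fun y x =>
    add_nonneg (dotProduct_self_nonneg' y) (dotProduct_self_nonneg' x)
  refine ⟨ε, k, hk, fun y x => hk1 _ _ (hs y x) (hlow y x), fun g y x hg hgΛ => ?_⟩
  simpa using hk2 _ _ 0 (hs y x) (by simpa using hdiss g y x hg hgΛ)

end Estimates

/-! ### Equivalence with the cascade -/

section Coordinates

variable {Ch Pr : Type*}

theorem Wtilde_zpr (K : Gains Ch Pr) (r : Setpoints Ch Pr) (q V a : Pr → ℝ) :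
    Wtilde K r (zpr K r q V a) V a = W q := by
  rw [Wtilde, zpr]
  congr 1
  ring

variable [Fintype Ch]

theorem WtildeX_toCascade (S : DHSystem Ch Pr) (K : Gains Ch Pr) (r : Setpoints Ch Pr)
    (x : State Ch Pr) : WtildeX S K r (toCascade S K r x).2 = W x.qpr := by
  ext i
  have hJ := (S.Jpr_pos i).ne'
  have ha := (K.Ma_pos i).ne'
  have h : x.qpr i - x.xa i + K.Nsh i * (x.Vsh i - r.Vsh i) + x.xa i
    - K.Nsh i * (x.Vsh i - r.Vsh i) = x.qpr i := by ring
  simp [WtildeX, Wtilde, W, toCascade, stack, zpr, hJ, ha, mul_div_cancel₀, mul_div_cancel_left₀, h]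

variable [Fintype Pr]


/-- The linear part of the change of coordinates `toCascade`. -/
noncomputable def toCascadeLinearEquiv (S : DHSystem Ch Pr) (K : Gains Ch Pr) :
    State Ch Pr ≃ₗ[ℝ] ((Ch → ℝ) × (Ch → ℝ)) × (HamIdx Pr → ℝ) where
  toFun h := ((h.qch, h.xch),
    stack (S.Jpr * (h.qpr - h.xa + K.Nsh * h.Vsh)) h.Vsh (h.xa / K.Ma) (h.xb / K.Mb))
  invFun p := (p.1.1, p.1.2,
    (fun i => p.2 (.inl (.inl i)) / S.Jpr i + K.Ma i * p.2 (.inr (.inl i))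
      - K.Nsh i * p.2 (.inl (.inr i))),
    (fun i => p.2 (.inl (.inr i))),
    (fun i => K.Ma i * p.2 (.inr (.inl i))), (fun i => K.Mb i * p.2 (.inr (.inr i))))
  map_add' h h' := by
    refine Prod.ext rfl ?_
    ext ((i | i) | (i | i)) <;>
      simp [stack, State.qpr, State.Vsh, State.xa, State.xb] <;> ring
  map_smul' c h := by
    refine Prod.ext rfl ?_
    ext ((i | i) | (i | i)) <;>
      simp [stack, State.qpr, State.Vsh, State.xa, State.xb] <;> ring
  left_inv h := by
    have hJ := fun i => (S.Jpr_pos i).ne'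
    have ha := fun i => (K.Ma_pos i).ne'
    have hb := fun i => (K.Mb_pos i).ne'
    ext i <;> simp [stack, State.qch, State.xch, State.qpr, State.Vsh, State.xa, State.xb, hJ, ha,
      hb, mul_div_cancel₀, mul_div_cancel_left₀]
    ring
  right_inv p := by
    have hJ := fun i => (S.Jpr_pos i).ne'
    have ha := fun i => (K.Ma_pos i).ne'
    have hb := fun i => (K.Mb_pos i).ne'
    refine Prod.ext rfl ?_
    ext ((i | i) | (i | i)) <;> simp [stack, State.qpr, State.Vsh, State.xa, State.xb, ha,
      hb, mul_div_cancel_left₀]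
    field_simp [hJ i]
    ring

theorem toCascade_eq (S : DHSystem Ch Pr) (K : Gains Ch Pr) (r : Setpoints Ch Pr)
    (x : State Ch Pr) :
    toCascade S K r x = (toCascadeLinearEquiv S K).toContinuousLinearEquiv x +
      ((0, 0), stack (-(S.Jpr * (K.Nsh * r.Vsh))) 0 0 0) := by
  refine Prod.ext (by simp [toCascade, toCascadeLinearEquiv]) ?_
  ext ((i | i) | (i | i)) <;> simp [toCascade, toCascadeLinearEquiv, stack, zpr]
  ring

theorem isHomeomorph_toCascade (S : DHSystem Ch Pr) (K : Gains Ch Pr) (r : Setpoints Ch Pr) :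
    IsHomeomorph (toCascade S K r) := by
  have := ((toCascadeLinearEquiv S K).toContinuousLinearEquiv.toHomeomorph.trans
    (Homeomorph.addRight ((0, 0), stack (-(S.Jpr * (K.Nsh * r.Vsh))) 0 0 0))).isHomeomorph
  convert! this using 1
  ext1 x
  exact toCascade_eq S K r x

variable [DecidableEq Pr]

theorem gradHamiltonian_eq (S : DHSystem Ch Pr) (K : Gains Ch Pr) (r : Setpoints Ch Pr)
    (X : HamIdx Pr → ℝ) :
    gradHamiltonian S K r X = stack S.Jpr⁻¹ 1 K.Ma K.Mb * (X - Xbar S K r) := by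
  set d : HamIdx Pr → ℝ := stack S.Jpr⁻¹ 1 K.Ma K.Mb with hd
  have hH : hamiltonian S K r = fun X => ∑ k, d k / 2 * (X k - Xbar S K r k) ^ 2 := by
    ext X
    simp only [hamiltonian, dotProduct, mulVec_diagonal, Finset.mul_sum, Pi.sub_apply, ← hd]
    exact Finset.sum_congr rfl fun k _ => by ring
  have hder : HasFDerivAt (hamiltonian S K r)
      (∑ k, (d k * (X k - Xbar S K r k)) • ContinuousLinearMap.proj (R := ℝ) (φ := fun _ => ℝ) k)
      X := by
    rw [hH]
    refine HasFDerivAt.fun_sum fun k _ => ?_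
    have h1 : HasFDerivAt (fun X : HamIdx Pr → ℝ => X k)
      (ContinuousLinearMap.proj (R := ℝ) (φ := fun _ => ℝ) k) X := hasFDerivAt_apply k X
    refine (((h1.sub_const (Xbar S K r k)).pow 2).const_mul (d k / 2)).congr_fderiv ?_
    ext Y
    simp
    ring
  ext k
  rw [gradHamiltonian, hder.fderiv, _root_.sum_apply, Finset.sum_eq_single k]
  · simp
  · intro j _ hj
    simp [hj]
  · simp

variable [DecidableEq Ch]

/-- The terms of `u_pr` in `M_a`, `N_sh` and `B q_ch` cancel the contributions of `ẋ_a` and `N_sh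
V̇_sh` to `J_pr ż_pr`. Only the linear part acts on the vector field, as the coordinate change is
affine. -/
theorem cascade_toCascade (S : DHSystem Ch Pr) (K : Gains Ch Pr) (r : Setpoints Ch Pr)
    (x : State Ch Pr) :
    cascade S K r (toCascade S K r x) =
      (toCascadeLinearEquiv S K).toContinuousLinearEquiv (closedLoop S K r x) := by
  refine Prod.ext ?_ ?_
  · refine Prod.ext ?_ ?_
    · simp only [cascade, sigmaCh, toCascade, toCascadeLinearEquiv, closedLoop, DHSystem.qchDot,
        uch, State.qch, State.xch]
      simp only [LinearEquiv.coe_toContinuousLinearEquiv', LinearEquiv.coe_mk, LinearMap.coe_mk,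
        AddHom.coe_mk]
      congr 1
      abel
    · rfl
  · ext k
    have hJ := fun i => (S.Jpr_pos i).ne'
    have ha := fun i => (K.Ma_pos i).ne'
    have hb := fun i => (K.Mb_pos i).ne'
    simp only [cascade, sigmaPrSh, gradHamiltonian_eq, structureMatrix, WtildeX_toCascade]
    simp only [closedLoop, Wtilde_zpr, upr, xbDot]
    rcases k with (i | i) | (i | i)
    all_goals
      simp [toCascade, toCascadeLinearEquiv, stack, mulVec, dotProduct, Matrix.diagonal_apply,
        Matrix.one_apply, State.qch, State.qpr, State.Vsh, State.xa, State.xb, Xbar, zpr, Psi,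
        Fintype.sum_sum_type, DHSystem.qprDot, DHSystem.fpr, DHSystem.VshDot, xaDot, W, mul_sub,
        Finset.sum_sub_distrib]
    all_goals
      have := hJ i
      have := ha i
      have := hb i
      field_simp <;> ring

/-- The chain rule with a constant linear isomorphism, used in both directions; the affine offset
has derivative zero. -/
theorem isSolutionOn_closedLoop_iff (S : DHSystem Ch Pr) (K : Gains Ch Pr) (r : Setpoints Ch Pr)
    (x : ℝ → State Ch Pr) (s : Set ℝ) :
    IsSolutionOn (closedLoop S K r) x s ↔
      IsSolutionOn (cascade S K r) (fun t => toCascade S K r (x t)) s := by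
  refine forall₂_congr fun t _ => ?_
  simp only [cascade_toCascade]
  simp only [toCascade_eq, hasDerivWithinAt_add_const_iff]
  set e := (toCascadeLinearEquiv S K).toContinuousLinearEquiv
  constructor
  · exact fun h => e.hasFDerivAt.comp_hasDerivWithinAt t h
  · intro h
    simpa [Function.comp_def] using e.symm.hasFDerivAt.comp_hasDerivWithinAt t h

end Coordinates

/-! ### Derivatives of the quadratic forms along trajectories -/

section Calculus

variable {ι κ : Type*} [Fintype ι] [Fintype κ]

theorem hasDerivWithinAt_dotProduct {u w : ℝ → ι → ℝ} {u' w' : ι → ℝ} {s : Set ℝ} {t : ℝ}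
    (hu : HasDerivWithinAt u u' s t) (hw : HasDerivWithinAt w w' s t) :
    HasDerivWithinAt (fun t => u t ⬝ᵥ w t) (u' ⬝ᵥ w t + u t ⬝ᵥ w') s t := by
  rw [hasDerivWithinAt_pi] at hu hw
  simp only [dotProduct, ← Finset.sum_add_distrib]
  exact HasDerivWithinAt.fun_sum fun i _ => (hu i).mul (hw i)

theorem hasDerivWithinAt_mulVec (A : Matrix κ ι ℝ) {u : ℝ → ι → ℝ} {u' : ι → ℝ} {s : Set ℝ}
    {t : ℝ} (hu : HasDerivWithinAt u u' s t) :
    HasDerivWithinAt (fun t => A *ᵥ u t) (A *ᵥ u') s t :=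
  (LinearMap.toContinuousLinearMap A.mulVecLin).hasFDerivAt.comp_hasDerivWithinAt t hu

theorem hasDerivWithinAt_fst {E F : Type*} [NormedAddCommGroup E] [NormedSpace ℝ E]
    [NormedAddCommGroup F] [NormedSpace ℝ F] {f : ℝ → E × F} {f' : E × F} {s : Set ℝ} {t : ℝ}
    (hf : HasDerivWithinAt f f' s t) : HasDerivWithinAt (fun t => (f t).1) f'.1 s t :=
  (ContinuousLinearMap.fst ℝ E F).hasFDerivAt.comp_hasDerivWithinAt t hf

theorem hasDerivWithinAt_snd {E F : Type*} [NormedAddCommGroup E] [NormedSpace ℝ E]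
    [NormedAddCommGroup F] [NormedSpace ℝ F] {f : ℝ → E × F} {f' : E × F} {s : Set ℝ} {t : ℝ}
    (hf : HasDerivWithinAt f f' s t) : HasDerivWithinAt (fun t => (f t).2) f'.2 s t :=
  (ContinuousLinearMap.snd ℝ E F).hasFDerivAt.comp_hasDerivWithinAt t hf

theorem contDiff_mulVec (A : Matrix κ ι ℝ) {n : WithTop ℕ∞} :
    ContDiff ℝ n (fun u : ι → ℝ => A *ᵥ u) :=
  (LinearMap.toContinuousLinearMap A.mulVecLin).contDiff

theorem contDiff_W : ContDiff ℝ 1 (W : (ι → ℝ) → ι → ℝ) :=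
  contDiff_pi.2 fun i => contDiff_abs_mul_self.comp (contDiff_apply ℝ ℝ i)

/-- Symmetry of `J` makes both halves of the kinetic term equal to `y ⬝ᵥ G`, and `M⁻¹` cancels the
integrator gain. -/
theorem hasDerivWithinAt_chForm {J : Matrix ι ι ℝ} (hJ : J.IsHermitian) {M : ι → ℝ}
    (hM : ∀ i, M i ≠ 0) (ε : ℝ) {y x : ℝ → ι → ℝ} {y' G : ι → ℝ} {s : Set ℝ} {t : ℝ}
    (hG : J *ᵥ y' = G)
    (hy : HasDerivWithinAt y y' s t) (hx : HasDerivWithinAt x (-(M * y t)) s t) :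
    HasDerivWithinAt (fun t => chForm J M ε (y t) (x t))
      (y t ⬝ᵥ G - x t ⬝ᵥ y t - ε * (-((M * y t) ⬝ᵥ (J *ᵥ y t)) + x t ⬝ᵥ G)) s t := by
  have hJy := hasDerivWithinAt_mulVec J hy
  rw [hG] at hJy
  have hMx : HasDerivWithinAt (fun t => M⁻¹ * x t) (-y t) s t := by
    rw [hasDerivWithinAt_pi] at hx ⊢
    intro i
    refine ((hx i).const_mul (M⁻¹ i)).congr_deriv ?_
    have := hM i
    simp only [Pi.neg_apply, Pi.mul_apply, Pi.inv_apply]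
    field_simp
  have hsymm : y' ⬝ᵥ (J *ᵥ y t) = y t ⬝ᵥ G := by
    rw [← hG, dotProduct_mulVec, ← mulVec_transpose, dotProduct_comm]
    have : Jᵀ = J := by simpa using hJ.eq
    rw [this]
  have hMM : (M * y t) ⬝ᵥ (M⁻¹ * x t) = x t ⬝ᵥ y t := by
    simp only [dotProduct]
    refine Finset.sum_congr rfl fun i _ => ?_
    have := hM i
    simp only [Pi.mul_apply, Pi.inv_apply]
    field_simp
  refine ((((hasDerivWithinAt_dotProduct hy hJy).add (hasDerivWithinAt_dotProduct hx hMx)).div_const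
    2).sub ((hasDerivWithinAt_dotProduct hx hJy).const_mul ε)).congr_deriv ?_
  simp only [neg_dotProduct, dotProduct_neg, hsymm, hMM]
  ring

/-- The numbers `w` and `ψ` are the values at time `t` only: the form contains the frozen `w₀`, so
neither is ever differentiated. -/
theorem hasDerivWithinAt_prForm {J Np Ns Ma Mb : ℝ} (hMa : Ma ≠ 0) (hMb : Mb ≠ 0)
    (w₀ w ψ ε : ℝ) {z v a b : ℝ → ℝ} {z' : ℝ} {s : Set ℝ} {t : ℝ}
    (hz' : J * z' = -Np * z t - v t + w * b t) (hz : HasDerivWithinAt z z' s t)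
    (hv : HasDerivWithinAt v (z t - Ns * v t + a t + ψ) s t)
    (ha : HasDerivWithinAt a (-(Ma * v t)) s t)
    (hb : HasDerivWithinAt b (-(Mb * (w * z t))) s t) :
    HasDerivWithinAt (fun t => prForm J Ma Mb w₀ ε (z t) (v t) (a t) (b t))
      (z t * (-Np * z t - v t + w * b t) + v t * (z t - Ns * v t + a t + ψ) - a t * v t
        - b t * (w * z t)
        - ε * (-Ma * v t * v t + a t * (z t - Ns * v t + a t + ψ)
          + w₀ * ((-Np * z t - v t + w * b t) * b t - J * z t * (Mb * w * z t)))) s t := by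
  refine ((((((hz.pow 2).const_mul J).add (hv.pow 2)).add ((ha.pow 2).div_const Ma)).add
    ((hb.pow 2).div_const Mb)).div_const 2 |>.sub
    (((ha.mul hv).add ((hz.mul hb).const_mul (w₀ * J))).const_mul ε)).congr_deriv ?_
  rw [← hz']
  field_simp
  ring

end Calculus

/-! ### The equilibrium, its uniqueness, and smoothness of the closed loop -/

section Equilibrium

variable {Ch Pr : Type*} [Fintype Ch]

/-- The equilibrium of the closed loop. -/
def equilibrium (S : DHSystem Ch Pr) (r : Setpoints Ch Pr) : State Ch Pr :=
  (r.qch, -S.fch r.qch, S.B *ᵥ r.qch, r.Vsh, S.B *ᵥ r.qch, S.θ)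

variable [DecidableEq Ch]

theorem mulVec_mulVec_inv {J : Matrix Ch Ch ℝ} (hJ : J.PosDef) (u : Ch → ℝ) :
    J *ᵥ (J⁻¹ *ᵥ u) = u := by
  rw [mulVec_mulVec, Matrix.mul_nonsing_inv _ ((Matrix.isUnit_iff_isUnit_det _).1 hJ.isUnit),
    one_mulVec]

variable [Fintype Pr]

theorem isEquilibrium_equilibrium (S : DHSystem Ch Pr) (K : Gains Ch Pr) (r : Setpoints Ch Pr) :
    IsEquilibrium (closedLoop S K r) (equilibrium S r) := by
  ext i <;> simp [closedLoop, equilibrium, State.qch, State.xch, State.qpr, State.Vsh, State.xa,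
    State.xb, DHSystem.qchDot, uch, xchDot, DHSystem.qprDot, DHSystem.fpr, upr, Wtilde, zpr,
    DHSystem.VshDot, xaDot, xbDot]

/-- Nonzero flows are used twice: `W z = 0` gives `z = 0`, hence `x_a = q_pr`, and then `W (x_b - θ)
= 0` gives `x_b = θ`. -/
theorem IsEquilibrium.eq_equilibrium {S : DHSystem Ch Pr} {K : Gains Ch Pr} {r : Setpoints Ch Pr}
    {x : State Ch Pr} (hx : IsEquilibrium (closedLoop S K r) x) (hne : ∀ i, x.qpr i ≠ 0) :
    x = equilibrium S r := by
  obtain ⟨q, xch, p, V, a, b⟩ := x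
  simp only [IsEquilibrium, closedLoop, Prod.mk_eq_zero, Wtilde_zpr, xbDot, upr] at hx
  simp only [State.qch, State.xch, State.qpr, State.Vsh, State.xa, State.xb] at hx hne
  obtain ⟨h1, h2, h3, h4, h5, h6⟩ := hx
  have hq : q = r.qch := by
    ext i
    have := congrFun h2 i
    simpa [xchDot, (K.Mch_pos i).ne', sub_eq_zero] using this
  have hV : V = r.Vsh := by
    ext i
    have := congrFun h5 i
    simpa [xaDot, (K.Ma_pos i).ne', sub_eq_zero] using this
  subst hq hV
  have hp : p = S.B *ᵥ r.qch := sub_eq_zero.1 h4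
  have hxch : xch = -S.fch r.qch := by
    have := congrArg (S.Jch *ᵥ ·) h1
    simp only [DHSystem.qchDot, mulVec_mulVec_inv S.Jch_posDef, mulVec_zero, uch] at this
    rw [sub_self, mul_zero, neg_zero, zero_add] at this
    exact (neg_eq_of_add_eq_zero_right this).symm
  have ha : a = p := by
    ext i
    have := congrFun h6 i
    simp [zpr, W, (K.Mb_pos i).ne', hne i, sub_eq_zero] at this
    exact this.symm
  have hb : b = S.θ := by
    ext i
    have := congrFun h3 i
    simp [DHSystem.qprDot, DHSystem.fpr, zpr, W, (S.Jpr_pos i).ne', ← hp, ha] at this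
    have h : |p i| * p i * (b i - S.θ i) = 0 := by linarith
    simpa [hne i, sub_eq_zero] using h
  rw [equilibrium, ← hp, hxch, ha, hb]

theorem contDiff_closedLoop (S : DHSystem Ch Pr) (K : Gains Ch Pr)
    (r : Setpoints Ch Pr) : ContDiff ℝ 1 (closedLoop S K r) := by
  have hq : ContDiff ℝ 1 (State.qch : State Ch Pr → _) := contDiff_fst
  have hxch : ContDiff ℝ 1 (State.xch : State Ch Pr → _) := contDiff_snd.fst
  have hp : ContDiff ℝ 1 (State.qpr : State Ch Pr → _) := contDiff_snd.snd.fst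
  have hV : ContDiff ℝ 1 (State.Vsh : State Ch Pr → _) := contDiff_snd.snd.snd.fst
  have ha : ContDiff ℝ 1 (State.xa : State Ch Pr → _) := contDiff_snd.snd.snd.snd.fst
  have hb : ContDiff ℝ 1 (State.xb : State Ch Pr → _) := contDiff_snd.snd.snd.snd.snd
  have hz : ContDiff ℝ 1 fun x : State Ch Pr => zpr K r x.qpr x.Vsh x.xa :=
    (hp.sub ha).add (contDiff_const.mul (hV.sub contDiff_const))
  have hW : ContDiff ℝ 1 fun x : State Ch Pr => W x.qpr := contDiff_W.comp hp
  have hBq : ContDiff ℝ 1 fun x : State Ch Pr => S.B *ᵥ x.qch := (contDiff_mulVec S.B).comp hq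
  unfold closedLoop
  simp only [Wtilde_zpr, xbDot, upr]
  refine ContDiff.prodMk ?_ (.prodMk ?_ (.prodMk ?_ (.prodMk ?_ (.prodMk ?_ ?_))))
  · exact (contDiff_mulVec _).comp ((S.fch_contDiff.comp hq).add
      ((contDiff_const.mul (hq.sub contDiff_const)).neg.add hxch))
  · exact (contDiff_const.mul (hq.sub contDiff_const)).neg
  · simp only [DHSystem.qprDot, DHSystem.fpr, div_eq_mul_inv]
    refine ContDiff.mul (.add (hW.mul contDiff_const).neg ?_) contDiff_const
    exact (((hW.mul hb).sub (contDiff_const.mul (hV.sub contDiff_const))).sub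
      (contDiff_const.mul hz)).add (contDiff_const.mul (hBq.sub ha))
  · exact hp.sub hBq
  · exact (contDiff_const.mul (hV.sub contDiff_const)).neg
  · exact (contDiff_const.mul (hW.mul hz)).neg

end Equilibrium

/-! ### The composite Lyapunov function and local asymptotic stability -/

section ClosedLoopLyapunov

variable {Ch Pr : Type*} [Fintype Ch] [Fintype Pr]

/-- The Lyapunov function of the closed loop, in terms of the deviation `h` from the
equilibrium. -/
noncomputable def lyapunov (S : DHSystem Ch Pr) (K : Gains Ch Pr) (w₀ : Pr → ℝ) (κ ε : ℝ)
    (kp εp : Pr → ℝ) (h : State Ch Pr) : ℝ :=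
  κ * chForm S.Jch K.Mch ε h.qch h.xch +
    ∑ i, kp i * prForm (S.Jpr i) (K.Ma i) (K.Mb i) (w₀ i) (εp i)
      (h.qpr i - h.xa i + K.Nsh i * h.Vsh i) (h.Vsh i) (h.xa i) (h.xb i)

/-- The sum of the squares of the deviations, with `z_pr` in the place of `q_pr`. -/
noncomputable def deviationSq (K : Gains Ch Pr) (h : State Ch Pr) : ℝ :=
  h.qch ⬝ᵥ h.qch + h.xch ⬝ᵥ h.xch +
    ∑ i, ((h.qpr i - h.xa i + K.Nsh i * h.Vsh i) ^ 2 + h.Vsh i ^ 2 + h.xa i ^ 2 + h.xb i ^ 2)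

theorem continuous_lyapunov (S : DHSystem Ch Pr) (K : Gains Ch Pr) (w₀ : Pr → ℝ) (κ ε : ℝ)
    (kp εp : Pr → ℝ) : Continuous (lyapunov S K w₀ κ ε kp εp) := by
  unfold lyapunov chForm prForm State.qch State.xch State.qpr State.Vsh State.xa State.xb
  fun_prop

theorem continuous_deviationSq (K : Gains Ch Pr) :
    Continuous (deviationSq K : State Ch Pr → ℝ) := by
  unfold deviationSq State.qch State.xch State.qpr State.Vsh State.xa State.xb
  fun_prop

/-- Homogeneity of degree two allows the comparison with `deviationSq` by compactness of the unit
sphere. -/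
theorem lyapunov_smul (S : DHSystem Ch Pr) (K : Gains Ch Pr) (w₀ : Pr → ℝ) (κ ε : ℝ)
    (kp εp : Pr → ℝ) (c : ℝ) (h : State Ch Pr) :
    lyapunov S K w₀ κ ε kp εp (c • h) = c ^ 2 * lyapunov S K w₀ κ ε kp εp h := by
  have hch : chForm S.Jch K.Mch ε (c • h.qch) (c • h.xch) =
      c ^ 2 * chForm S.Jch K.Mch ε h.qch h.xch := by
    simp only [chForm, mulVec_smul, mul_smul_comm, smul_dotProduct, dotProduct_smul, smul_eq_mul]
    ring
  change κ * chForm S.Jch K.Mch ε (c • h.qch) (c • h.xch) + ∑ i, kp i * prForm _ _ _ _ _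
    (c * h.qpr i - c * h.xa i + K.Nsh i * (c * h.Vsh i)) (c * h.Vsh i) (c * h.xa i) (c * h.xb i) = _
  rw [hch, lyapunov, mul_add, Finset.mul_sum]
  congr 1
  · ring
  · refine Finset.sum_congr rfl fun i _ => ?_
    simp only [prForm]
    ring

theorem deviationSq_smul (K : Gains Ch Pr) (c : ℝ) (h : State Ch Pr) :
    deviationSq K (c • h) = c ^ 2 * deviationSq K h := by
  change (c • h.qch) ⬝ᵥ (c • h.qch) + (c • h.xch) ⬝ᵥ (c • h.xch) + ∑ i,
    ((c * h.qpr i - c * h.xa i + K.Nsh i * (c * h.Vsh i)) ^ 2 + (c * h.Vsh i) ^ 2 +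
      (c * h.xa i) ^ 2 + (c * h.xb i) ^ 2) = _
  rw [deviationSq, mul_add, mul_add, Finset.mul_sum]
  congr 1
  · simp only [smul_dotProduct, dotProduct_smul, smul_eq_mul]
    ring
  · exact Finset.sum_congr rfl fun i _ => by ring

theorem deviationSq_pos (K : Gains Ch Pr) {h : State Ch Pr} (hh : h ≠ 0) :
    0 < deviationSq K h := by
  have hnn : ∀ i, 0 ≤ (h.qpr i - h.xa i + K.Nsh i * h.Vsh i) ^ 2 + h.Vsh i ^ 2 + h.xa i ^ 2 +
    h.xb i ^ 2 := fun i => by positivity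
  have h1 := dotProduct_self_nonneg' h.qch
  have h2 := dotProduct_self_nonneg' h.xch
  have h3 := Finset.sum_nonneg fun i (_ : i ∈ Finset.univ) => hnn i
  refine lt_of_le_of_ne (add_nonneg (add_nonneg h1 h2) h3) fun h0 => hh ?_
  rw [deviationSq] at h0
  have e1 : h.qch = 0 := dotProduct_self_eq_zero.1 (by linarith)
  have e2 : h.xch = 0 := dotProduct_self_eq_zero.1 (by linarith)
  have e3 := (Finset.sum_eq_zero_iff_of_nonneg fun i _ => hnn i).1
    (by linarith : ∑ i, ((h.qpr i - h.xa i + K.Nsh i * h.Vsh i) ^ 2 + h.Vsh i ^ 2 + h.xa i ^ 2 +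
      h.xb i ^ 2) = 0)
  have e4 : ∀ i, h.qpr i = 0 ∧ h.Vsh i = 0 ∧ h.xa i = 0 ∧ h.xb i = 0 := fun i => by
    have e := e3 i (Finset.mem_univ i)
    have hz := sq_nonneg (h.qpr i - h.xa i + K.Nsh i * h.Vsh i)
    have hv : h.Vsh i = 0 := by
      nlinarith [sq_nonneg (h.Vsh i), sq_nonneg (h.xa i), sq_nonneg (h.xb i)]
    have ha : h.xa i = 0 := by
      nlinarith [sq_nonneg (h.Vsh i), sq_nonneg (h.xa i), sq_nonneg (h.xb i)]
    have hb : h.xb i = 0 := by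
      nlinarith [sq_nonneg (h.Vsh i), sq_nonneg (h.xa i), sq_nonneg (h.xb i)]
    rw [hv, ha, hb] at e
    exact ⟨by simpa using e, hv, ha, hb⟩
  exact Prod.ext e1 (Prod.ext e2 (Prod.ext (funext fun i => (e4 i).1)
    (Prod.ext (funext fun i => (e4 i).2.1) (Prod.ext (funext fun i => (e4 i).2.2.1)
      (funext fun i => (e4 i).2.2.2)))))

/-- The derivative of the Lyapunov function along the solutions of the closed loop. -/
noncomputable def lyapunovDot (S : DHSystem Ch Pr) (K : Gains Ch Pr) (r : Setpoints Ch Pr)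
    (w₀ : Pr → ℝ) (κ ε : ℝ) (kp εp : Pr → ℝ) (x : State Ch Pr) : ℝ :=
  let h := x - equilibrium S r
  let g := S.fch x.qch - S.fch r.qch
  κ * (h.qch ⬝ᵥ (g - K.Nch * h.qch + h.xch) - h.xch ⬝ᵥ h.qch
    - ε * (-((K.Mch * h.qch) ⬝ᵥ (S.Jch *ᵥ h.qch)) + h.xch ⬝ᵥ (g - K.Nch * h.qch + h.xch))) +
  ∑ i, kp i *
    (let z := h.qpr i - h.xa i + K.Nsh i * h.Vsh i
     let v := h.Vsh i
     let a := h.xa i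
     let b := h.xb i
     let w := W x.qpr i
     let ψ := (S.B *ᵥ (-h.qch)) i
     z * (-K.Npr i * z - v + w * b) + v * (z - K.Nsh i * v + a + ψ) - a * v - b * (w * z)
      - εp i * (-K.Ma i * v * v + a * (z - K.Nsh i * v + a + ψ)
        + w₀ i * ((-K.Npr i * z - v + w * b) * b - S.Jpr i * z * (K.Mb i * w * z))))

variable [DecidableEq Ch]

theorem hasDerivWithinAt_lyapunov (S : DHSystem Ch Pr) (K : Gains Ch Pr) (r : Setpoints Ch Pr)
    (w₀ : Pr → ℝ) (κ ε : ℝ) (kp εp : Pr → ℝ) {x : ℝ → State Ch Pr} {s : Set ℝ} {t : ℝ}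
    (hx : HasDerivWithinAt x (closedLoop S K r (x t)) s t) :
    HasDerivWithinAt (fun t => lyapunov S K w₀ κ ε kp εp (x t - equilibrium S r))
      (lyapunovDot S K r w₀ κ ε kp εp (x t)) s t := by
  have hh := hx.sub_const (equilibrium S r)
  have hq : HasDerivWithinAt (fun t => (x t - equilibrium S r).qch)
      (closedLoop S K r (x t)).qch s t := hasDerivWithinAt_fst hh
  have hh2 := hasDerivWithinAt_snd hh
  have hxch : HasDerivWithinAt (fun t => (x t - equilibrium S r).xch)
      (closedLoop S K r (x t)).xch s t := hasDerivWithinAt_fst hh2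
  have hh3 := hasDerivWithinAt_snd hh2
  have hp : HasDerivWithinAt (fun t => (x t - equilibrium S r).qpr)
      (closedLoop S K r (x t)).qpr s t := hasDerivWithinAt_fst hh3
  have hh4 := hasDerivWithinAt_snd hh3
  have hV : HasDerivWithinAt (fun t => (x t - equilibrium S r).Vsh)
      (closedLoop S K r (x t)).Vsh s t := hasDerivWithinAt_fst hh4
  have hh5 := hasDerivWithinAt_snd hh4
  have ha : HasDerivWithinAt (fun t => (x t - equilibrium S r).xa)
      (closedLoop S K r (x t)).xa s t := hasDerivWithinAt_fst hh5
  have hb : HasDerivWithinAt (fun t => (x t - equilibrium S r).xb)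
      (closedLoop S K r (x t)).xb s t := hasDerivWithinAt_snd hh5
  have hpi : ∀ i, HasDerivWithinAt (fun t => (x t - equilibrium S r).qpr i)
      ((closedLoop S K r (x t)).qpr i) s t := hasDerivWithinAt_pi.1 hp
  have hVi : ∀ i, HasDerivWithinAt (fun t => (x t - equilibrium S r).Vsh i)
      ((closedLoop S K r (x t)).Vsh i) s t := hasDerivWithinAt_pi.1 hV
  have hai : ∀ i, HasDerivWithinAt (fun t => (x t - equilibrium S r).xa i)
      ((closedLoop S K r (x t)).xa i) s t := hasDerivWithinAt_pi.1 ha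
  have hbi : ∀ i, HasDerivWithinAt (fun t => (x t - equilibrium S r).xb i)
      ((closedLoop S K r (x t)).xb i) s t := hasDerivWithinAt_pi.1 hb
  have hzi : ∀ i, HasDerivWithinAt (fun t => (x t - equilibrium S r).qpr i
      - (x t - equilibrium S r).xa i + K.Nsh i * (x t - equilibrium S r).Vsh i)
      ((closedLoop S K r (x t)).qpr i - (closedLoop S K r (x t)).xa i
        + K.Nsh i * (closedLoop S K r (x t)).Vsh i) s t := fun i =>
    ((hpi i).sub (hai i)).add ((hVi i).const_mul (K.Nsh i))
  have eq : (x t).qch = (x t - equilibrium S r).qch + r.qch := (sub_add_cancel _ _).symm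
  have exch : (x t).xch = (x t - equilibrium S r).xch - S.fch r.qch := (sub_add_cancel _ _).symm
  have ep : (x t).qpr = (x t - equilibrium S r).qpr + S.B *ᵥ r.qch := (sub_add_cancel _ _).symm
  have eV : (x t).Vsh = (x t - equilibrium S r).Vsh + r.Vsh := (sub_add_cancel _ _).symm
  have ea : (x t).xa = (x t - equilibrium S r).xa + S.B *ᵥ r.qch := (sub_add_cancel _ _).symm
  have eb : (x t).xb = (x t - equilibrium S r).xb + S.θ := (sub_add_cancel _ _).symm
  have d1 : (closedLoop S K r (x t)).qch = S.Jch⁻¹ *ᵥ (S.fch (x t).qch - S.fch r.qch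
      - K.Nch * (x t - equilibrium S r).qch + (x t - equilibrium S r).xch) := by
    change S.Jch⁻¹ *ᵥ (S.fch (x t).qch + (-(K.Nch * ((x t).qch - r.qch)) + (x t).xch)) = _
    rw [exch, show (x t).qch - r.qch = (x t - equilibrium S r).qch from rfl]
    congr 1
    abel
  have hz : ∀ i, zpr K r (x t).qpr (x t).Vsh (x t).xa i = (x t - equilibrium S r).qpr i
      - (x t - equilibrium S r).xa i + K.Nsh i * (x t - equilibrium S r).Vsh i := fun i => by
    simp only [zpr, ep, eV, ea, Pi.add_apply, Pi.sub_apply, Pi.mul_apply]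
    ring
  have hBq : ∀ i, (S.B *ᵥ (x t).qch) i =
      (S.B *ᵥ (x t - equilibrium S r).qch) i + (S.B *ᵥ r.qch) i := fun i => by
    rw [eq, mulVec_add]; rfl
  have hpdot : ∀ i, S.Jpr i * (closedLoop S K r (x t)).qpr i =
      -(W (x t).qpr i * S.θ i) + upr S K r (zpr K r (x t).qpr (x t).Vsh (x t).xa)
        (x t).Vsh (x t).xa (x t).xb (S.B *ᵥ (x t).qch) i := fun i =>
    mul_div_cancel₀ _ (S.Jpr_pos i).ne'
  refine ((hasDerivWithinAt_chForm S.Jch_posDef.1 (fun i => (K.Mch_pos i).ne') ε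
    ?_ hq hxch).const_mul κ).add (HasDerivWithinAt.fun_sum fun i _ => ?_)
  · rw [d1, mulVec_mulVec_inv S.Jch_posDef]
  · refine (hasDerivWithinAt_prForm (K.Ma_pos i).ne' (K.Mb_pos i).ne' (w₀ i) (W (x t).qpr i)
      ((S.B *ᵥ (-(x t - equilibrium S r).qch)) i) (εp i) ?_ (hzi i) ((hVi i).congr_deriv ?_) (hai i)
      ((hbi i).congr_deriv ?_)).const_mul (kp i)
    · have hVdot : (closedLoop S K r (x t)).Vsh i = (x t).qpr i - (S.B *ᵥ (x t).qch) i := rfl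
      have hadot : (closedLoop S K r (x t)).xa i = -(K.Ma i * (x t - equilibrium S r).Vsh i) := rfl
      have hupr : upr S K r (zpr K r (x t).qpr (x t).Vsh (x t).xa) (x t).Vsh (x t).xa (x t).xb
          (S.B *ᵥ (x t).qch) i = W (x t).qpr i * (x t).xb i
            - (S.Jpr i * (K.Ma i - K.Nsh i ^ 2) + 1) * ((x t).Vsh i - r.Vsh i)
            - (S.Jpr i * K.Nsh i + K.Npr i) * zpr K r (x t).qpr (x t).Vsh (x t).xa i
            + S.Jpr i * K.Nsh i * ((S.B *ᵥ (x t).qch) i - (x t).xa i) := by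
        rw [upr, Wtilde_zpr]
        rfl
      have ep' : (x t).qpr i = (x t - equilibrium S r).qpr i + (S.B *ᵥ r.qch) i := congrFun ep i
      have eV' : (x t).Vsh i = (x t - equilibrium S r).Vsh i + r.Vsh i := congrFun eV i
      have ea' : (x t).xa i = (x t - equilibrium S r).xa i + (S.B *ᵥ r.qch) i := congrFun ea i
      have eb' : (x t).xb i = (x t - equilibrium S r).xb i + S.θ i := congrFun eb i
      -- The feedback cancellation, now in deviations: `θ` disappears against the equilibrium value
      -- of `x_b`.
      rw [mul_add, mul_sub, hpdot, hupr, hVdot, hadot, hz, eV', ea', eb', ep']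
      ring
    · change (x t).qpr i - (S.B *ᵥ (x t).qch) i = _
      rw [hBq, ep, mulVec_neg]
      simp only [Pi.add_apply, Pi.neg_apply]
      ring
    · change -(K.Mb i * (Wtilde K r (zpr K r (x t).qpr (x t).Vsh (x t).xa) (x t).Vsh (x t).xa i *
        zpr K r (x t).qpr (x t).Vsh (x t).xa i)) = _
      rw [Wtilde_zpr, hz]

theorem isLocallyAsymptoticallyStable_equilibrium (S : DHSystem Ch Pr) (K : Gains Ch Pr)
    (r : Setpoints Ch Pr) (hne : ∀ i, (S.B *ᵥ r.qch) i ≠ 0) :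
    IsLocallyAsymptoticallyStable (closedLoop S K r) (equilibrium S r) := by
  set w₀ : Pr → ℝ := W (S.B *ᵥ r.qch) with hw₀
  have hw₀ne : ∀ i, w₀ i ≠ 0 := fun i => mul_ne_zero (abs_ne_zero.2 (hne i)) (hne i)
  have hself2 : ∀ (a : ℝ) (u : Ch → ℝ), (a • u) ⬝ᵥ (a • u) = a ^ 2 * (u ⬝ᵥ u) := fun a u => by
    simp only [smul_dotProduct, dotProduct_smul, smul_eq_mul]; ring
  have hselfc : Continuous fun u : Ch → ℝ => u ⬝ᵥ u := by fun_prop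
  -- A `C¹` map is locally Lipschitz in the sup norm; `c₁` and `c₂` convert the bound to dot
  -- products.
  obtain ⟨Λ, hΛ⟩ : ∃ Λ : ℝ, ∀ᶠ q in 𝓝 r.qch, (S.fch q - S.fch r.qch) ⬝ᵥ (S.fch q - S.fch r.qch) ≤
      Λ * ((q - r.qch) ⬝ᵥ (q - r.qch)) := by
    obtain ⟨L, t, ht, hL⟩ := (S.fch_contDiff.contDiffAt (x := r.qch)).exists_lipschitzOnWith
    obtain ⟨c₁, hc₁, h₁⟩ := exists_le_mul_of_homogeneous (Q := fun u : Ch → ℝ => ‖u‖ ^ 2)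
      (by fun_prop) hselfc (fun a u => by simp [norm_smul, mul_pow]) hself2
      fun u hu => by have := norm_pos_iff.2 hu; positivity
    obtain ⟨c₂, hc₂, h₂⟩ := exists_le_mul_of_homogeneous (R := fun u : Ch → ℝ => ‖u‖ ^ 2)
      hselfc (by fun_prop) hself2 (fun a u => by simp [norm_smul, mul_pow])
      fun u hu => dotProduct_self_pos hu
    refine ⟨c₁ * (L ^ 2 * c₂), ?_⟩
    filter_upwards [ht] with q hq
    have h := hL.norm_sub_le hq (mem_of_mem_nhds ht)
    calc _ ≤ c₁ * ‖S.fch q - S.fch r.qch‖ ^ 2 := h₁ _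
      _ ≤ c₁ * (L * ‖q - r.qch‖) ^ 2 := by gcongr
      _ = c₁ * (L ^ 2 * ‖q - r.qch‖ ^ 2) := by ring
      _ ≤ c₁ * (L ^ 2 * (c₂ * ((q - r.qch) ⬝ᵥ (q - r.qch)))) := by gcongr; exact h₂ _
      _ = _ := by ring
  obtain ⟨ε, k, hk, hklow, hkdiss⟩ := exists_chForm_bounds S.Jch_posDef K.Mch_pos K.Nch_pos Λ
  choose εp kp Cp hkp hCp hplow hpdiss using fun i => exists_prForm_bounds (S.Jpr_pos i)
    (K.Npr_pos i) (K.Nsh_pos i) (K.Ma_pos i) (K.Mb_pos i) (hw₀ne i)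
  obtain ⟨c, hc, hcψ⟩ := exists_le_mul_of_homogeneous
    (R := fun u : Ch → ℝ => ∑ i, Cp i * ((S.B *ᵥ (-u)) i) ^ 2) hselfc (by fun_prop) hself2
    (fun a u => by
      simp only [mulVec_neg, mulVec_smul, Pi.neg_apply, Pi.smul_apply, smul_eq_mul,
        Finset.mul_sum]
      exact Finset.sum_congr rfl fun i _ => by ring)
    fun u hu => dotProduct_self_pos hu
  -- The inputs cost the producers at most `c` times `|q_ch - q_ch⋆|²` (Euclidean). The factor `1 +
  -- c` pays this and leaves one full copy.
  set V := lyapunov S K w₀ ((1 + c) * k) ε kp εp with hV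
  have hlow : ∀ h, deviationSq K h ≤ V h := fun h => by
    have h1 := hklow h.qch h.xch
    have h2 := Finset.sum_le_sum fun i (_ : i ∈ Finset.univ) => hplow i
      (h.qpr i - h.xa i + K.Nsh i * h.Vsh i) (h.Vsh i) (h.xa i) (h.xb i)
    have h3 : 0 ≤ c * (k * chForm S.Jch K.Mch ε h.qch h.xch) := mul_nonneg hc.le
      ((add_nonneg (dotProduct_self_nonneg' _) (dotProduct_self_nonneg' _)).trans h1)
    rw [hV, deviationSq, lyapunov]
    linarith
  obtain ⟨C₁, hC₁, hnorm⟩ := exists_le_mul_of_homogeneous (R := fun h : State Ch Pr => ‖h‖ ^ 2)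
    (continuous_deviationSq K) (by fun_prop) (deviationSq_smul K)
    (fun a u => by rw [norm_smul, mul_pow, Real.norm_eq_abs, sq_abs])
    fun h hh => deviationSq_pos K hh
  obtain ⟨C₂, hC₂, hup⟩ := exists_le_mul_of_homogeneous (R := V)
    (continuous_deviationSq K) (continuous_lyapunov S K w₀ _ ε kp εp) (deviationSq_smul K)
    (lyapunov_smul S K w₀ _ ε kp εp) fun h hh => deviationSq_pos K hh
  have hV0 : V 0 = 0 := by
    simpa using lyapunov_smul S K w₀ ((1 + c) * k) ε kp εp 0 0
  refine isLocallyAsymptoticallyStable_of_lyapunov (contDiff_closedLoop S K r).contDiffAt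
    (isEquilibrium_equilibrium S K r) (V := fun x => V (x - equilibrium S r))
    (D := lyapunovDot S K r w₀ ((1 + c) * k) ε kp εp) (C := C₁) (c := C₂⁻¹) ?_ ?_ hC₁ ?_
    (inv_pos.2 hC₂) ?_ fun x s t hx => hasDerivWithinAt_lyapunov S K r w₀ _ ε kp εp hx
  · exact ((continuous_lyapunov S K w₀ _ ε kp εp).comp
      (continuous_id.sub continuous_const)).continuousAt
  · simpa using hV0
  · exact fun x => (hnorm _).trans (mul_le_mul_of_nonneg_left (hlow _) hC₁.le)
  · have hqc : Tendsto (State.qch : State Ch Pr → _) (𝓝 (equilibrium S r)) (𝓝 r.qch) :=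
      continuous_fst.tendsto (equilibrium S r)
    have hpc : Continuous (State.qpr : State Ch Pr → _) := continuous_snd.snd.fst
    have hwc : ∀ i, Tendsto (fun x : State Ch Pr => w₀ i * W x.qpr i) (𝓝 (equilibrium S r))
        (𝓝 (w₀ i * w₀ i)) := fun i =>
      (continuous_const.mul ((continuous_apply i).comp
        (contDiff_W.continuous.comp hpc))).tendsto (equilibrium S r)
    have hw2 : ∀ i, 0 < w₀ i ^ 2 := fun i => by have := hw₀ne i; positivity
    -- The products tend to `w₀ i ^ 2 > 0`, so the window of `exists_prForm_bounds` holds near the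
    -- equilibrium. This confines the argument to a neighbourhood, as does the bound with `Λ`.
    have hw1 : ∀ᶠ x in 𝓝 (equilibrium S r), ∀ i, w₀ i ^ 2 / 2 < w₀ i * W x.qpr i :=
      eventually_all.2 fun i => (hwc i).eventually (lt_mem_nhds (by nlinarith [hw2 i]))
    have hw3 : ∀ᶠ x in 𝓝 (equilibrium S r), ∀ i, w₀ i * W x.qpr i < 2 * w₀ i ^ 2 :=
      eventually_all.2 fun i => (hwc i).eventually (gt_mem_nhds (by nlinarith [hw2 i]))
    filter_upwards [hqc.eventually hΛ, hw1, hw3] with x hxΛ hx1 hx2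
    have hmono : (x.qch - r.qch) ⬝ᵥ (S.fch x.qch - S.fch r.qch) ≤ 0 := by
      have := S.fch_monotone x.qch r.qch
      rw [← neg_sub' , dotProduct_neg] at this
      linarith
    set h := x - equilibrium S r with hh
    have h1 := hkdiss (S.fch x.qch - S.fch r.qch) h.qch h.xch hmono hxΛ
    have h2 := Finset.sum_le_sum fun i (_ : i ∈ Finset.univ) => hpdiss i (W x.qpr i) (hx1 i).le
      (hx2 i).le ((S.B *ᵥ (-h.qch)) i)
      (h.qpr i - h.xa i + K.Nsh i * h.Vsh i) (h.Vsh i) (h.xa i) (h.xb i)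
    rw [Finset.sum_add_distrib, Finset.sum_neg_distrib] at h2
    have h3 := hcψ h.qch
    have h4 := mul_le_mul_of_nonneg_left h1 (show 0 ≤ 1 + c by positivity)
    have h5 : C₂⁻¹ * V h ≤ deviationSq K h := by
      rw [inv_mul_le_iff₀ hC₂]; exact hup h
    have h6 : 0 ≤ c * (h.xch ⬝ᵥ h.xch) := mul_nonneg hc.le (dotProduct_self_nonneg' _)
    have h7 : lyapunovDot S K r w₀ ((1 + c) * k) ε kp εp x ≤ -deviationSq K h := by
      rw [deviationSq, lyapunovDot]
      dsimp only
      rw [← hh]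
      rw [← mul_assoc] at h4
      linarith
    linarith

end ClosedLoopLyapunov

end DistrictHeating

/-! ### The main theorem -/

theorem theorem1 {Ch Pr : Type*} [Fintype Ch] [DecidableEq Ch] [Fintype Pr] [DecidableEq Pr]
    (S : DHSystem Ch Pr) (K : Gains Ch Pr) (r : Setpoints Ch Pr) :
    -- the overall closed loop is the cascade of the two subsystems, up to a change of coordinates
    (IsHomeomorph (toCascade S K r) ∧
      ∀ (x : ℝ → State Ch Pr) (s : Set ℝ),
        IsSolutionOn (closedLoop S K r) x s ↔
          IsSolutionOn (cascade S K r) (fun t => toCascade S K r (x t)) s) ∧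
    -- unique, locally asymptotically stable equilibrium, and regulation to the setpoints near it
    ((∀ xe : State Ch Pr, IsEquilibrium (closedLoop S K r) xe → ∀ i, xe.qpr i ≠ 0) →
      ∃ xe : State Ch Pr,
        (∀ x : State Ch Pr, IsEquilibrium (closedLoop S K r) x ↔ x = xe) ∧
        IsLocallyAsymptoticallyStable (closedLoop S K r) xe ∧
        ∃ δ > 0, ∀ x : ℝ → State Ch Pr,
          IsSolutionOn (closedLoop S K r) x (Set.Ici 0) → dist (x 0) xe < δ →
            Tendsto (fun t => (x t).qch) atTop (𝓝 r.qch) ∧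
            Tendsto (fun t => (x t).Vsh) atTop (𝓝 r.Vsh)) := by
  refine ⟨⟨isHomeomorph_toCascade S K r, isSolutionOn_closedLoop_iff S K r⟩, fun hne => ?_⟩
  -- The explicit equilibrium exists unconditionally, so the hypothesis applied to it says that all
  -- entries of `B q_ch⋆` are nonzero.
  have hstable := isLocallyAsymptoticallyStable_equilibrium S K r
    (hne _ (isEquilibrium_equilibrium S K r))
  refine ⟨equilibrium S r, fun x => ⟨fun hx => hx.eq_equilibrium (hne x hx), ?_⟩, hstable, ?_⟩
  · rintro rfl
    exact isEquilibrium_equilibrium S K r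
  · obtain ⟨δ, hδ, hattr⟩ := hstable.2.2
    refine ⟨δ, hδ, fun x hx h0 => ?_⟩
    have hlim := (hattr (x 0) h0).2 x rfl hx
    exact ⟨(continuous_fst.tendsto (equilibrium S r)).comp hlim,
      (continuous_snd.snd.snd.fst.tendsto (equilibrium S r)).comp hlim⟩
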